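/- **Model and conventions.** Let $K$ be a field. Computations over $K$ are algebraic computation trees: each operation $+,-,\times,/$ (division only by nonzero elements) and each test whether an element of $K$ is zero costs one operation in $K$; loading constants of $K$ is free. A real number $\omega$ is a feasible exponent for matrix multiplication over $K$ if for some constant $c$ and every $n\ge 0$ two $n\times n$ matrices over $K$ can be multiplied with at most $c\,n^{\omega}$ operations in $K$; as usual we assume $\omega>2$. Let $R=K[X_1,\dots,X_r]$ and let $e_1,\dots,e_m$ be the coordinate vectors of $R^m$. A monomial of $R^m$ is $X^{a}e_i$ with $a\in\mathbb N^r$, $1\le i\le m$; it divides $X^{b}e_j$ if $i=j$ and $a\le b$ entrywise. A monomial order on $R^m$ is a total order $\prec$ on these monomials such that $\mu\prec\nu$ implies $\mu\prec\kappa\mu\prec\kappa\nu$ for every monomial $\kappa\ne 1$ of $R$. The leading term of $f\neq 0$ is its term with the $\prec$-greatest monomial. The reduced $\prec$-Gröbner basis of a submodule $N\subseteq R^m$ is the finite set $G\subset N\setminus\{0\}$ whose leading terms generate the submodule generated by the leading terms of all nonzero elements of $N$, and such that the leading term of each $g\in G$ is monic and divides no term of any other element of $G$. For pairwise commuting $M_1,\dots,M_r\in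 K^{D\times D}$ and $F\in K^{m\times D}$ with rows $f_1,\dots,f_m$, put $p\cdot F=f_1\,p_1(M_1,\dots,M_r)+\cdots+f_m\,p_m(M_1,\dots,M_r)$ for $p=(p_1,\dots,p_m)\in R^m$; the syzygy module is $\{p\in R^m : p\cdot F=0\}$. **Theorem.** Let $\omega>2$ and $c$ be real numbers. There is a constant $C$, depending only on $\omega$ and $c$, such that the following holds for every field $K$ over which, for all $n$, two $n\times n$ matrices can be multiplied with at most $c\,n^{\omega}$ operations in $K$, and for all integers $r,m,D\ge1$. There is an algebraic computation tree over $K$ which takes as input a monomial order $\prec$ on $R^m$ (accessed through comparisons of two monomials, which cost no operations in $K$), the entries of pairwise commuting matrices $M_1,\dots,M_r\in K^{D\times D}$ and the entries of $F\in K^{m\times D}$, and which returns, on every such input, the reduced $\prec$-Gröbner basis of $\{p\in R^m : p\cdot F=0\}$ after at most $$C\Bigl(m D^{\omega-1}+D^{\omega}\bigl(r+\log(d_1\cdots d_r)\bigr)\Bigr)$$ operations in $K$, where $d_k\in\{1,\dots,D\}$ is the degree of the minimal polynomial of $M_k$. If $D\ge2$, the number of operations is also at most $C\bigl(m D^{\omega-1}+r\,D^{\omega}\log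 D\bigr)$. -/

import Mathlib

universe u

namespace SyzygyGB

/-! ## Computation trees with a count of the field operations -/

/-- The four arithmetic operations of a field. -/
inductive ArithOp where
  | add
  | sub
  | mul
  | div

open Classical in
/-- The result of an arithmetic operation; a division by zero has no result. -/
noncomputable def ArithOp.eval {K : Type u} [Field K] : ArithOp → K → K → Option K
  | .add, a, b => some (a + b)
  | .sub, a, b => some (a - b)
  | .mul, a, b => some (a * b)
  | .div, a, b => if b = 0 then none else some (a / b)

/-- Algebraic computation trees over `K`. The input is a family of field elements indexed by `ι`;
there is a workspace of registers indexed by `ℕ`. An operand is either an input entry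
(`Sum.inl`) or a workspace register (`Sum.inr`). The field elements can be accessed only through
arithmetic operations and tests for zero. Besides, a tree may put yes/no questions from `Q` to
an oracle that represents the non-algebraic part of the input. Each leaf carries an output
description of type `O`, which may refer to input entries and registers. -/
inductive CompTree (K : Type u) (ι Q O : Type) : Type u where
  /-- stop with the given output description -/
  | halt (out : O)
  /-- load a constant into the register `dst` -/
  | const (dst : ℕ) (c : K) (next : CompTree K ι Q O)
  /-- apply an arithmetic operation to `a` and `b`, and store the result in `dst` -/
  | arith (op : ArithOp) (dst : ℕ) (a b : ι ⊕ ℕ) (next : CompTree K ι Q O)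
  /-- branch according to whether `a` is zero -/
  | ifZero (a : ι ⊕ ℕ) (yes no : CompTree K ι Q O)
  /-- branch according to the answer of the oracle -/
  | query (q : Q) (yes no : CompTree K ι Q O)

/-- What a computation leaves when it stops: the number of operations in the field that were
performed, the content of all input entries and registers, and the output description. -/
structure Outcome (K : Type u) (ι O : Type) where
  cost : ℕ
  value : ι ⊕ ℕ → K
  out : O

/-- Add `k` operations to the cost. -/
def Outcome.charge {K : Type u} {ι O : Type} (k : ℕ) (s : Outcome K ι O) : Outcome K ι O :=
  { s with cost := s.cost + k }

open Classical in
/-- Run a computation tree on the input `x`, with the oracle `oracle` and the workspace `w`.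
Each arithmetic operation and each test for zero costs one operation in the field.
The result is `none` if a division by zero is attempted. -/
noncomputable def CompTree.runFrom {K : Type u} [Field K] {ι Q O : Type}
    (x : ι → K) (oracle : Q → Prop) : CompTree K ι Q O → (ℕ → K) → Option (Outcome K ι O)
  | .halt out, w => some ⟨0, Sum.elim x w, out⟩
  | .const dst c next, w => next.runFrom x oracle (Function.update w dst c)
  | .arith op dst a b next, w =>
      (op.eval (Sum.elim x w a) (Sum.elim x w b)).bind fun v =>
        (next.runFrom x oracle (Function.update w dst v)).map (Outcome.charge 1)
  | .ifZero a yes no, w =>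
      (if Sum.elim x w a = 0 then yes.runFrom x oracle w else no.runFrom x oracle w).map
        (Outcome.charge 1)
  | .query q yes no, w =>
      if oracle q then yes.runFrom x oracle w else no.runFrom x oracle w

/-- Run a computation tree from the workspace that holds `0` everywhere. -/
noncomputable def CompTree.run {K : Type u} [Field K] {ι Q O : Type}
    (P : CompTree K ι Q O) (x : ι → K) (oracle : Q → Prop) : Option (Outcome K ι O) :=
  P.runFrom x oracle fun _ => 0

/-! ## Matrix multiplication -/

/-- The entries of two `n × n` matrices. -/
abbrev MatMulInput (n : ℕ) : Type := (Fin n × Fin n) ⊕ (Fin n × Fin n)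

/-- The input family that holds the entries of `A` and `B`. -/
def matMulInput {K : Type u} {n : ℕ} (A B : Matrix (Fin n) (Fin n) K) : MatMulInput n → K :=
  Sum.elim (fun ij => A ij.1 ij.2) (fun ij => B ij.1 ij.2)

/-- For all `n`, two `n × n` matrices over `K` can be multiplied with at most `c * n ^ ω`
operations in `K`; there is no oracle, and the output says where each entry of the product
is found. So `ω` is a feasible exponent of matrix multiplication over `K` iff this
holds for some `c`. -/
def MatMulIn (K : Type u) [Field K] (ω c : ℝ) : Prop :=
  ∀ n : ℕ, ∃ P : CompTree K (MatMulInput n) Empty (Fin n → Fin n → MatMulInput n ⊕ ℕ),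
    ∀ A B : Matrix (Fin n) (Fin n) K, ∃ s, P.run (matMulInput A B) Empty.elim = some s ∧
      (s.cost : ℝ) ≤ c * (n : ℝ) ^ ω ∧ ∀ i j, s.value (s.out i j) = (A * B) i j

/-! ## Monomials, monomial orders and Gröbner bases in `K[X_1, …, X_r]^m` -/

/-- The monomials of `K[X_1, …, X_r]^m`: the pair `(i, e)` stands for `X^e` times the `i`-th
coordinate vector. -/
abbrev Mon (r m : ℕ) : Type := Fin m × (Fin r →₀ ℕ)

/-- The product of the monomial `X^κ` of the ring and a monomial of the free module. -/
noncomputable def Mon.mulBy {r m : ℕ} (κ : Fin r →₀ ℕ) (μ : Mon r m) : Mon r m := (μ.1, κ + μ.2)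

/-- Divisibility of monomials of the free module. -/
def Mon.Divides {r m : ℕ} (μ ν : Mon r m) : Prop := μ.1 = ν.1 ∧ μ.2 ≤ ν.2

/-- Monomial orders on `K[X_1, …, X_r]^m`: strict total orders on the monomials such that
`μ ≺ ν` implies `μ ≺ κ μ ≺ κ ν` for all monomials `κ ≠ 1` of the ring. -/
structure ModuleMonomialOrder (r m : ℕ) where
  lt : Mon r m → Mon r m → Prop
  irrefl : ∀ μ, ¬ lt μ μ
  trans : ∀ μ ν ξ, lt μ ν → lt ν ξ → lt μ ξ
  total : ∀ μ ν, lt μ ν ∨ μ = ν ∨ lt ν μ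
  lt_mulBy : ∀ (μ ν : Mon r m) (κ : Fin r →₀ ℕ), κ ≠ 0 → lt μ ν →
    lt μ (μ.mulBy κ) ∧ lt (μ.mulBy κ) (ν.mulBy κ)

/-- The free module `K[X_1, …, X_r]^m`. -/
abbrev FreeMod (K : Type u) [Field K] (r m : ℕ) : Type u := Fin m → MvPolynomial (Fin r) K

/-- The coefficient of `f` at a monomial of the free module. -/
noncomputable def coeffAt {K : Type u} [Field K] {r m : ℕ} (f : FreeMod K r m) (μ : Mon r m) : K :=
  MvPolynomial.coeff μ.2 (f μ.1)

/-- The element `a X^e e_i` of the free module, for `μ = (i, e)`. -/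
noncomputable def term {K : Type u} [Field K] {r m : ℕ} (μ : Mon r m) (a : K) : FreeMod K r m :=
  Pi.single μ.1 (MvPolynomial.monomial μ.2 a)

/-- `μ` is the leading monomial of `f`: the greatest monomial that occurs in `f`. -/
def IsLeadingMon {K : Type u} [Field K] {r m : ℕ} (ord : ModuleMonomialOrder r m)
    (f : FreeMod K r m) (μ : Mon r m) : Prop :=
  coeffAt f μ ≠ 0 ∧ ∀ ν, coeffAt f ν ≠ 0 → ν ≠ μ → ord.lt ν μ

/-- The set of the leading terms of the nonzero elements of `S`. -/
def leadingTerms {K : Type u} [Field K] {r m : ℕ} (ord : ModuleMonomialOrder r m)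
    (S : Set (FreeMod K r m)) : Set (FreeMod K r m) :=
  {t | ∃ f ∈ S, ∃ μ, IsLeadingMon ord f μ ∧ t = term μ (coeffAt f μ)}

/-- `G` is the reduced Gröbner basis of the submodule `N`: a finite subset of `N` whose leading
terms generate the leading module of `N`, such that the leading term of each element of `G` is
monic and divides no term of another element of `G`. -/
structure IsReducedGroebnerBasis {K : Type u} [Field K] {r m : ℕ} (ord : ModuleMonomialOrder r m)
    (N : Submodule (MvPolynomial (Fin r) K) (FreeMod K r m)) (G : Set (FreeMod K r m)) : Prop where
  finite : G.Finite
  subset : G ⊆ N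
  span_eq : Submodule.span (MvPolynomial (Fin r) K) (leadingTerms ord (N : Set (FreeMod K r m))) =
    Submodule.span (MvPolynomial (Fin r) K) (leadingTerms ord G)
  monic : ∀ f ∈ G, ∃ μ, IsLeadingMon ord f μ ∧ coeffAt f μ = 1
  reduced : ∀ f ∈ G, ∀ g ∈ G, f ≠ g → ∀ μ, IsLeadingMon ord f μ →
    ∀ ν, coeffAt g ν ≠ 0 → ¬ μ.Divides ν

/-! ## The module of syzygies -/

/-- `M^e = M_1^{e_1} ⋯ M_r^{e_r}`. -/
def matPow {K : Type u} [Field K] {r D : ℕ} (M : Fin r → Matrix (Fin D) (Fin D) K)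
    (e : Fin r →₀ ℕ) : Matrix (Fin D) (Fin D) K :=
  (List.ofFn fun k => M k ^ e k).prod

/-- `p(M_1, …, M_r)` for a polynomial `p`. -/
noncomputable def evalMat {K : Type u} [Field K] {r D : ℕ} (M : Fin r → Matrix (Fin D) (Fin D) K)
    (p : MvPolynomial (Fin r) K) : Matrix (Fin D) (Fin D) K :=
  p.support.sum fun e => MvPolynomial.coeff e p • matPow M e

/-- `p · F = f_1 p_1(M) + ⋯ + f_m p_m(M)`, where `f_1, …, f_m` are the rows of `F`. -/
noncomputable def act {K : Type u} [Field K] {r m D : ℕ} (M : Fin r → Matrix (Fin D) (Fin D) K)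
    (F : Matrix (Fin m) (Fin D) K) (p : FreeMod K r m) : Fin D → K :=
  ∑ i, Matrix.vecMul (F i) (evalMat M (p i))

section helpers

variable {K : Type u} [Field K]

theorem prod_ofFn_mul {A : Type*} [Monoid A] : ∀ {r : ℕ} (f g : Fin r → A),
    (∀ i j, Commute (g i) (f j)) →
    (List.ofFn fun k => f k * g k).prod = (List.ofFn f).prod * (List.ofFn g).prod
  | 0, f, g, _ => by simp
  | r + 1, f, g, h => by
    have hc : Commute (g 0) (List.ofFn fun k : Fin r => f k.succ).prod := by
      apply Commute.list_prod_right
      intro x hx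
      obtain ⟨k, rfl⟩ := (List.mem_ofFn' _ _).1 hx
      exact h _ _
    simp only [List.ofFn_succ, List.prod_cons]
    rw [prod_ofFn_mul (fun k : Fin r => f k.succ) (fun k => g k.succ) fun i j => h _ _]
    simp only [mul_assoc]
    congr 1
    rw [← mul_assoc, hc.eq, mul_assoc]

theorem matPow_add {r D : ℕ} {M : Fin r → Matrix (Fin D) (Fin D) K}
    (hM : ∀ i j, Commute (M i) (M j)) (e e' : Fin r →₀ ℕ) :
    matPow M (e + e') = matPow M e * matPow M e' := by
  unfold matPow
  rw [← prod_ofFn_mul _ _ fun i j => (hM i j).pow_pow _ _]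
  simp [pow_add]

theorem evalMat_eq_sum {r D : ℕ} (M : Fin r → Matrix (Fin D) (Fin D) K)
    (p : MvPolynomial (Fin r) K) (s : Finset (Fin r →₀ ℕ)) (hs : p.support ⊆ s) :
    evalMat M p = s.sum fun e => MvPolynomial.coeff e p • matPow M e := by
  apply Finset.sum_subset hs
  intro e _ he
  rw [MvPolynomial.notMem_support_iff.1 he, zero_smul]

theorem evalMat_add {r D : ℕ} (M : Fin r → Matrix (Fin D) (Fin D) K)
    (p q : MvPolynomial (Fin r) K) : evalMat M (p + q) = evalMat M p + evalMat M q := by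
  classical
  rw [evalMat_eq_sum M (p + q) (p.support ∪ q.support) MvPolynomial.support_add,
    evalMat_eq_sum M p _ Finset.subset_union_left,
    evalMat_eq_sum M q _ Finset.subset_union_right, ← Finset.sum_add_distrib]
  simp [add_smul]

theorem evalMat_zero {r D : ℕ} (M : Fin r → Matrix (Fin D) (Fin D) K) : evalMat M 0 = 0 := by
  simp [evalMat]

theorem evalMat_monomial {r D : ℕ} (M : Fin r → Matrix (Fin D) (Fin D) K)
    (e : Fin r →₀ ℕ) (a : K) : evalMat M (MvPolynomial.monomial e a) = a • matPow M e := by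
  classical
  rw [evalMat_eq_sum M _ {e} MvPolynomial.support_monomial_subset]
  simp

theorem evalMat_mul {r D : ℕ} {M : Fin r → Matrix (Fin D) (Fin D) K}
    (hM : ∀ i j, Commute (M i) (M j)) (p q : MvPolynomial (Fin r) K) :
    evalMat M (p * q) = evalMat M p * evalMat M q := by
  induction p using MvPolynomial.induction_on' with
  | add p p' hp hp' => rw [add_mul, evalMat_add, hp, hp', evalMat_add, add_mul]
  | monomial e a =>
    induction q using MvPolynomial.induction_on' with
    | add q q' hq hq' => rw [mul_add, evalMat_add, hq, hq', evalMat_add, mul_add]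
    | monomial e' b =>
      rw [MvPolynomial.monomial_mul, evalMat_monomial, evalMat_monomial, evalMat_monomial,
        matPow_add hM, smul_mul_smul_comm]

theorem act_add {r m D : ℕ} (M : Fin r → Matrix (Fin D) (Fin D) K)
    (F : Matrix (Fin m) (Fin D) K) (p q : FreeMod K r m) :
    act M F (p + q) = act M F p + act M F q := by
  simp [act, evalMat_add, Matrix.vecMul_add, Finset.sum_add_distrib]

theorem act_smul {r m D : ℕ} {M : Fin r → Matrix (Fin D) (Fin D) K}
    (hM : ∀ i j, Commute (M i) (M j)) (F : Matrix (Fin m) (Fin D) K)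
    (a : MvPolynomial (Fin r) K) (p : FreeMod K r m) :
    act M F (a • p) = Matrix.vecMul (act M F p) (evalMat M a) := by
  simp only [act, Pi.smul_apply, smul_eq_mul, Matrix.sum_vecMul, Matrix.vecMul_vecMul]
  refine Finset.sum_congr rfl fun i _ => ?_
  rw [mul_comm, evalMat_mul hM]

end helpers

/-- The module of syzygies `{p | p · F = 0}` for pairwise commuting matrices `M_1, …, M_r`. -/
noncomputable def syzygyModule {K : Type u} [Field K] {r m D : ℕ}
    (M : Fin r → Matrix (Fin D) (Fin D) K) (hM : ∀ i j, Commute (M i) (M j))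
    (F : Matrix (Fin m) (Fin D) K) : Submodule (MvPolynomial (Fin r) K) (FreeMod K r m) where
  carrier := {p | act M F p = 0}
  zero_mem' := by simp [act, evalMat_zero]
  add_mem' := by
    intro p q hp hq
    simp only [Set.mem_ofPred_eq] at hp hq ⊢
    rw [act_add, hp, hq, add_zero]
  smul_mem' := by
    intro a p hp
    simp only [Set.mem_ofPred_eq] at hp ⊢
    rw [act_smul hM, hp, Matrix.zero_vecMul]

/-! ## The computational problem -/

/-- The entries of `r` matrices of size `D × D` and of one matrix of size `m × D`. -/
abbrev SyzygyInput (r m D : ℕ) : Type := (Fin r × Fin D × Fin D) ⊕ (Fin m × Fin D)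

/-- The input family that holds the entries of the matrices `M_1, …, M_r` and `F`. -/
def syzygyInput {K : Type u} {r m D : ℕ} (M : Fin r → Matrix (Fin D) (Fin D) K)
    (F : Matrix (Fin m) (Fin D) K) : SyzygyInput r m D → K :=
  Sum.elim (fun x => M x.1 x.2.1 x.2.2) (fun x => F x.1 x.2)

/-- Output descriptions: a list of elements of the free module, each of them written as a list of
monomials together with the places where their coefficients are found. -/
abbrev SyzygyOutput (r m D : ℕ) : Type := List (List (Mon r m × (SyzygyInput r m D ⊕ ℕ)))

/-- The set of elements of the free module that an output description stands for. -/
noncomputable def Outcome.elements {K : Type u} [Field K] {r m D : ℕ}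
    (s : Outcome K (SyzygyInput r m D) (SyzygyOutput r m D)) : Set (FreeMod K r m) :=
  {f | ∃ l ∈ s.out, f = (l.map fun t => term t.1 (s.value t.2)).sum}

/-- Computation trees for the syzygy problem: the input entries are those of the matrices, and the
oracle compares two monomials with respect to the given monomial order. -/
abbrev SyzygyTree (K : Type u) (r m D : ℕ) : Type u :=
  CompTree K (SyzygyInput r m D) (Mon r m × Mon r m) (SyzygyOutput r m D)

/-- On the input `(ord, M, F)`, the tree `P` stops with the reduced Gröbner basis of the module of
syzygies after at most `B` operations in the field. -/
def SyzygyTree.Solves {K : Type u} [Field K] {r m D : ℕ} (P : SyzygyTree K r m D)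
    (ord : ModuleMonomialOrder r m) (M : Fin r → Matrix (Fin D) (Fin D) K)
    (hM : ∀ i j, Commute (M i) (M j)) (F : Matrix (Fin m) (Fin D) K) (B : ℝ) : Prop :=
  ∃ s, P.run (syzygyInput M F) (fun q => ord.lt q.1 q.2) = some s ∧
    IsReducedGroebnerBasis ord (syzygyModule M hM F) s.elements ∧ (s.cost : ℝ) ≤ B

end SyzygyGB

/-!
The vector of a monomial `μ = X^e e_i` is the row `f_i M^e`. A monomial is *standard* if its
vector is not a combination of the vectors of smaller monomials. The standard monomials are
exactly those which are not leading monomials of syzygies; they are closed under division, their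
vectors are linearly independent, and the vector of any other monomial is a combination of the
vectors of smaller standard monomials. Therefore the reduced Gröbner basis consists of the
relations between the minimal nonstandard monomials and their normal forms
(`isReducedGroebnerBasis_of_normalForms`), and each minimal nonstandard monomial is a coordinate
vector or a variable times a standard monomial.

To find the standard monomials of a finite set of monomials, sort the set (comparisons are free)
and compute the row rank profile of the matrix of the vectors (`IsPivot.image_eq_standardMons`).
The rank profile comes together with the inverse of a maximal invertible submatrix. Both are
computed by recursion on the rows: eliminate the second half of the rows with the pivots of the
first half, recurse, and merge by the block inversion formula for Schur complements
(`IsPivot.merge`). The cost is geometric because `ω > 2` (`exists_pivots_two_pow`), and matrices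
with many rows are treated in blocks (`exists_pivots`).

The variables are treated one after the other. In the variable `k`, the standard monomials of
degree less than `2b` are found among those of degree less than `b` and their multiples by
`X_k^b`, so that repeated squaring of `M_k` and one rank profile for at most `2D` rows double the
degree bound (`exists_doubling`). The doubling stops as soon as it yields nothing new
(`IsEquivariant.standardMons_of_stable`), and a standard monomial has degree less than `d_k` in
`X_k` (`standardMons_firstVars_subset`); so there are at most `⌈log₂ d_k⌉ + 1` steps
(`exists_doublings`). Finally, all normal forms are obtained by multiplying the vectors of the
candidates by the inverse matrix (`exists_output`).

Programs are written in a small monadic language above computation trees in which every operation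
writes to a fresh register; `Spec` is the corresponding Hoare triple, with a bound on the cost.
Since the trees for matrix multiplication are only known to exist, all programs are produced
existentially, uniformly in the data they will be run on.
-/

namespace SyzygyGB

/-! ### Programs over computation trees -/

section Programs

variable {K : Type u} {ι Q : Type}

/-- Grafting: run the first computation tree, then the one determined by its output. -/
def CompTree.bind {O O' : Type} :
    CompTree K ι Q O → (O → CompTree K ι Q O') → CompTree K ι Q O'
  | .halt out, f => f out
  | .const dst c next, f => .const dst c (next.bind f)
  | .arith op dst a b next, f => .arith op dst a b (next.bind f)
  | .ifZero a yes no, f => .ifZero a (yes.bind f) (no.bind f)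
  | .query q yes no, f => .query q (yes.bind f) (no.bind f)

/-- A program with result in `α`: given the number of the first free register, a computation tree
which returns the result together with the number of the first register that is then free.
Results mention field elements only through the places where they are stored. -/
def Prog (K : Type u) (ι Q : Type) (α : Type) : Type u := ℕ → CompTree K ι Q (α × ℕ)

instance : Monad (Prog K ι Q) where
  pure a := fun n => .halt (a, n)
  bind p f := fun n => (p n).bind fun r => f r.1 r.2

/-- The state of the workspace: the number of the first free register, and the contents. -/
structure Mem (K : Type u) where
  next : ℕ
  val : ℕ → K

/-- `s ≤ t` if `t` may follow `s`: the registers in use in `s` keep their contents. -/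
instance : Preorder (Mem K) where
  le s t := s.next ≤ t.next ∧ ∀ j < s.next, t.val j = s.val j
  le_refl s := ⟨le_rfl, fun _ _ => rfl⟩
  le_trans s t r h h' :=
    ⟨h.1.trans h'.1, fun j hj => (h'.2 j (hj.trans_le h.1)).trans (h.2 j hj)⟩

/-- The part of the input that stays fixed during a computation: the field elements, and the
oracle. -/
structure Env (K : Type u) (ι Q : Type) where
  input : ι → K
  oracle : Q → Prop

/-- The operand `o` holds the field element `v`, and it is protected from being overwritten. -/
def Has (E : Env K ι Q) (s : Mem K) : ι ⊕ ℕ → K → Prop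
  | .inl i, v => E.input i = v
  | .inr j, v => j < s.next ∧ s.val j = v

theorem Has.mono {E : Env K ι Q} {s t : Mem K} {o : ι ⊕ ℕ} {v : K} (h : Has E s o v)
    (hst : s ≤ t) : Has E t o v := by
  cases o with
  | inl i => exact h
  | inr j => exact ⟨h.1.trans_le hst.1, (hst.2 j h.1).trans h.2⟩

theorem Has.value_eq {E : Env K ι Q} {s : Mem K} {o : ι ⊕ ℕ} {v : K} (h : Has E s o v) :
    Sum.elim E.input s.val o = v := by
  cases o with
  | inl i => exact h
  | inr j => exact h.2

theorem Mem.le_push (s : Mem K) (v : K) : s ≤ ⟨s.next + 1, Function.update s.val s.next v⟩ :=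
  ⟨Nat.le_succ _, fun _ hj => Function.update_of_ne hj.ne _ _⟩

variable [Field K]

theorem CompTree.runFrom_bind {O O' : Type} (x : ι → K) (oracle : Q → Prop)
    (f : O → CompTree K ι Q O') (t : CompTree K ι Q O) :
    ∀ (w w' : ℕ → K) (k : ℕ) (a : O),
      t.runFrom x oracle w = some ⟨k, Sum.elim x w', a⟩ →
        (t.bind f).runFrom x oracle w = ((f a).runFrom x oracle w').map (Outcome.charge k) := by
  have charge_succ : ∀ (k : ℕ) (o : Option (Outcome K ι O')),
      (o.map (Outcome.charge k)).map (Outcome.charge 1) = o.map (Outcome.charge (k + 1)) := by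
    intro k o
    cases o <;> simp [Outcome.charge, add_assoc]
  have of_map : ∀ {o : Option (Outcome K ι O)} {k : ℕ} {v : ι ⊕ ℕ → K} {a : O},
      o.map (Outcome.charge 1) = some ⟨k, v, a⟩ → ∃ k', k = k' + 1 ∧ o = some ⟨k', v, a⟩ := by
    intro o k v a h
    obtain ⟨⟨k', v', a'⟩, rfl, h'⟩ := Option.map_eq_some_iff.1 h
    simp only [Outcome.charge, Outcome.mk.injEq] at h'
    obtain ⟨rfl, rfl, rfl⟩ := h'
    exact ⟨k', rfl, rfl⟩
  induction t with
  | halt out =>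
    intro w w' k a h
    simp only [CompTree.runFrom, Option.some.injEq, Outcome.mk.injEq] at h
    obtain ⟨rfl, hw, rfl⟩ := h
    have : w = w' := funext fun j => congrFun hw (Sum.inr j)
    subst this
    have hid : (Outcome.charge 0 : Outcome K ι O' → _) = id := by
      funext s; simp [Outcome.charge]
    simp [CompTree.bind, hid]
  | const dst c next ih =>
    intro w w' k a h
    exact ih _ _ _ _ h
  | arith op dst a b next ih =>
    intro w w' k r h
    simp only [CompTree.runFrom, CompTree.bind] at h ⊢
    cases hv : op.eval (Sum.elim x w a) (Sum.elim x w b) with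
    | none => simp [hv] at h
    | some v =>
      simp only [hv, Option.bind_some] at h ⊢
      obtain ⟨k', rfl, h'⟩ := of_map h
      rw [ih _ _ _ _ h', charge_succ]
  | ifZero a yes no ihy ihn =>
    intro w w' k r h
    simp only [CompTree.runFrom, CompTree.bind] at h ⊢
    obtain ⟨k', rfl, h'⟩ := of_map h
    split_ifs at h' ⊢ with h0
    · rw [ihy _ _ _ _ h', charge_succ]
    · rw [ihn _ _ _ _ h', charge_succ]
  | query q yes no ihy ihn =>
    intro w w' k r h
    simp only [CompTree.runFrom, CompTree.bind] at h ⊢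
    split_ifs at h ⊢ with h0
    · exact ihy _ _ _ _ h
    · exact ihn _ _ _ _ h

/-- Started in the state `s`, the program `p` stops after at most `b` operations in the field,
does not touch the registers in use, and its result and final state satisfy `Post`. -/
def Spec {α : Type} (E : Env K ι Q) (s : Mem K) (p : Prog K ι Q α) (b : ℝ)
    (Post : α → Mem K → Prop) : Prop :=
  ∃ (k : ℕ) (t : Mem K) (a : α),
    (p s.next).runFrom E.input E.oracle s.val = some ⟨k, Sum.elim E.input t.val, (a, t.next)⟩ ∧
      s ≤ t ∧ (k : ℝ) ≤ b ∧ Post a t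

variable {E : Env K ι Q} {s : Mem K} {α β : Type}

theorem Spec.mono {p : Prog K ι Q α} {b b' : ℝ} {Post Post' : α → Mem K → Prop}
    (h : Spec E s p b Post) (hb : b ≤ b') (hP : ∀ a t, s ≤ t → Post a t → Post' a t) :
    Spec E s p b' Post' := by
  obtain ⟨k, t, a, h1, h2, h3, h4⟩ := h
  exact ⟨k, t, a, h1, h2, h3.trans hb, hP a t h2 h4⟩

theorem Spec.pure {a : α} {Post : α → Mem K → Prop} (h : Post a s) :
    Spec E s (pure a : Prog K ι Q α) 0 Post :=
  ⟨0, s, a, rfl, le_rfl, by simp, h⟩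

theorem Spec.bind {p : Prog K ι Q α} {f : α → Prog K ι Q β} {b b' : ℝ}
    {P : α → Mem K → Prop} {P' : β → Mem K → Prop} (hp : Spec E s p b P)
    (hf : ∀ a t, s ≤ t → P a t → Spec E t (f a) b' P') : Spec E s (p >>= f) (b + b') P' := by
  obtain ⟨k, t, a, h1, h2, h3, h4⟩ := hp
  obtain ⟨k', t', a', h1', h2', h3', h4'⟩ := hf a t h2 h4
  refine ⟨k' + k, t', a', ?_, h2.trans h2', ?_, h4'⟩
  · change ((p s.next).bind fun r => f r.1 r.2).runFrom _ _ _ = _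
    rw [CompTree.runFrom_bind _ _ _ _ _ _ _ _ h1, h1']
    rfl
  · push_cast
    linarith

/-- The bound `b'` on the cost of the whole leaves `b' - b` for what follows the first part. -/
theorem Spec.step {p : Prog K ι Q α} {f : α → Prog K ι Q β} {b b' : ℝ}
    {P : α → Mem K → Prop} {P' : β → Mem K → Prop} (hp : Spec E s p b P)
    (hf : ∀ a t, s ≤ t → P a t → Spec E t (f a) (b' - b) P') : Spec E s (p >>= f) b' P' :=
  (hp.bind hf).mono (by linarith) fun _ _ _ h => h

theorem Spec.done {a : α} {b : ℝ} {Post : α → Mem K → Prop} (hb : 0 ≤ b) (h : Post a s) :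
    Spec E s (Pure.pure a : Prog K ι Q α) b Post :=
  (Spec.pure h).mono hb fun _ _ _ h => h

/-- Load a constant into a fresh register. -/
def Prog.const (c : K) : Prog K ι Q (ι ⊕ ℕ) := fun n => .const n c (.halt (.inr n, n + 1))

/-- Apply an arithmetic operation, with the result in a fresh register. -/
def Prog.arith (op : ArithOp) (a b : ι ⊕ ℕ) : Prog K ι Q (ι ⊕ ℕ) := fun n =>
  .arith op n a b (.halt (.inr n, n + 1))

/-- Branch according to whether an operand is zero. -/
def Prog.ifZero (o : ι ⊕ ℕ) (yes no : Prog K ι Q α) : Prog K ι Q α := fun n =>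
  .ifZero o (yes n) (no n)

/-- Ask the oracle. -/
def Prog.ask (q : Q) : Prog K ι Q Prop := fun n => .query q (.halt (True, n)) (.halt (False, n))

theorem Spec.const (c : K) :
    Spec E s (Prog.const c) 0 fun o t => Has E t o c :=
  ⟨0, ⟨s.next + 1, Function.update s.val s.next c⟩, .inr s.next, rfl, s.le_push c, by simp,
    Nat.lt_succ_self _, Function.update_self _ _ _⟩

theorem Spec.arith {op : ArithOp} {a b : ι ⊕ ℕ} {u v r : K} (ha : Has E s a u)
    (hb : Has E s b v) (h : op.eval u v = some r) :
    Spec E s (Prog.arith op a b) 1 fun o t => Has E t o r := by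
  refine ⟨1, ⟨s.next + 1, Function.update s.val s.next r⟩, .inr s.next, ?_, s.le_push r, by simp,
    Nat.lt_succ_self _, Function.update_self _ _ _⟩
  simp [Prog.arith, CompTree.runFrom, ha.value_eq, hb.value_eq, h, Outcome.charge]

theorem Spec.ifZero {o : ι ⊕ ℕ} {v : K} {yes no : Prog K ι Q α} {b : ℝ}
    {Post : α → Mem K → Prop} (ho : Has E s o v) (hy : v = 0 → Spec E s yes b Post)
    (hn : v ≠ 0 → Spec E s no b Post) : Spec E s (Prog.ifZero o yes no) (b + 1) Post := by
  by_cases h0 : v = 0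
  · obtain ⟨k, t, a, h1, h2, h3, h4⟩ := hy h0
    refine ⟨k + 1, t, a, ?_, h2, by push_cast; linarith, h4⟩
    simp only [Prog.ifZero, CompTree.runFrom, ho.value_eq, h0, if_true, h1]
    rfl
  · obtain ⟨k, t, a, h1, h2, h3, h4⟩ := hn h0
    refine ⟨k + 1, t, a, ?_, h2, by push_cast; linarith, h4⟩
    simp only [Prog.ifZero, CompTree.runFrom, ho.value_eq, h0, if_false, h1]
    rfl

theorem Spec.ask (q : Q) :
    Spec E s (Prog.ask (K := K) (ι := ι) q) 0 fun a _ => a ↔ E.oracle q := by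
  by_cases h : E.oracle q
  · exact ⟨0, s, True, by simp [Prog.ask, CompTree.runFrom, h], le_rfl, by simp, by simp [h]⟩
  · exact ⟨0, s, False, by simp [Prog.ask, CompTree.runFrom, h], le_rfl, by simp, by simp [h]⟩

open Classical in
/-- Run a program for each entry of a list, and collect the results. -/
noncomputable def Prog.forEach [Inhabited β] (f : α → Prog K ι Q β) : List α → Prog K ι Q (α → β)
  | [] => Pure.pure fun _ => default
  | a :: l => f a >>= fun o => Prog.forEach f l >>= fun g => Pure.pure (Function.update g a o)

theorem Spec.forEach_list [Inhabited β] {f : α → Prog K ι Q β} {b : ℝ}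
    {P : α → β → Mem K → Prop} (hP : ∀ a o t t', t ≤ t' → P a o t → P a o t') (l : List α) :
    ∀ s : Mem K, (∀ a ∈ l, ∀ t, s ≤ t → Spec E t (f a) b (P a)) →
      Spec E s (Prog.forEach f l) (l.length * b) fun g t => ∀ a ∈ l, P a (g a) t := by
  classical
  induction l with
  | nil => intro s _; exact (Spec.pure (by simp)).mono (by simp) fun _ _ _ h => h
  | cons a l ih =>
    intro s hs
    refine ((hs a (by simp) s le_rfl).bind fun o t hst ho =>
      (ih t fun a' ha' t' ht' => hs a' (by simp [ha']) t' (hst.trans ht')).bind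
        (b' := 0) fun g t' htt' hg => Spec.pure ?_).mono
          (by simp only [List.length_cons]; push_cast; linarith) fun _ _ _ h => h
    intro a' ha'
    by_cases h : a' = a
    · subst h
      simpa using hP _ _ _ _ htt' ho
    · rw [Function.update_of_ne h]
      exact hg a' ((List.mem_cons.1 ha').resolve_left h)

theorem Spec.forEach [Inhabited β] {f : α → Prog K ι Q β} {b : ℝ} {P : α → β → Mem K → Prop}
    (hP : ∀ a o t t', t ≤ t' → P a o t → P a o t') (S : Finset α)
    (hf : ∀ a ∈ S, ∀ t, s ≤ t → Spec E t (f a) b (P a)) :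
    Spec E s (Prog.forEach f S.toList) (S.card * b) fun g t => ∀ a ∈ S, P a (g a) t := by
  have := Spec.forEach_list hP S.toList s fun a ha => hf a (Finset.mem_toList.1 ha)
  rw [Finset.length_toList] at this
  exact this.mono le_rfl fun g t _ h a ha => h a (Finset.mem_toList.2 ha)

/-- Questions to the oracle are free, so any finite number of answers may be assumed known. -/
theorem Spec.askAll (S : Finset Q) :
    Spec E s (Prog.forEach (K := K) (ι := ι) Prog.ask S.toList) 0
      fun R _ => ∀ q ∈ S, (R q ↔ E.oracle q) :=
  (Spec.forEach (P := fun q a _ => a ↔ E.oracle q) (fun _ _ _ _ _ h => h) S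
    fun q _ _ _ => Spec.ask q).mono (by simp) fun _ _ _ h => h

/-- Embed a computation tree without oracle as a subprogram. The current place of each of its
input entries and registers is recorded; each register is written only once. The result is the
output of the tree together with the final places. -/
noncomputable def Prog.call {ι' O : Type} :
    CompTree K ι' Empty O → (ι' ⊕ ℕ → ι ⊕ ℕ) → Prog K ι Q (O × (ι' ⊕ ℕ → ι ⊕ ℕ))
  | .halt out, ρ => Pure.pure (out, ρ)
  | .const dst c next, ρ =>
      Prog.const c >>= fun o => Prog.call next (Sum.elim (ρ ∘ .inl) (Function.update (ρ ∘ .inr) dst o))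
  | .arith op dst a b next, ρ =>
      Prog.arith op (ρ a) (ρ b) >>= fun o =>
        Prog.call next (Sum.elim (ρ ∘ .inl) (Function.update (ρ ∘ .inr) dst o))
  | .ifZero a yes no, ρ => Prog.ifZero (ρ a) (Prog.call yes ρ) (Prog.call no ρ)
  | .query q _ _, _ => q.elim

theorem Spec.call {ι' O : Type} (x : ι' → K) (T : CompTree K ι' Empty O) :
    ∀ (w : ℕ → K) (s : Mem K) (ρ : ι' ⊕ ℕ → ι ⊕ ℕ) (r : Outcome K ι' O),
      T.runFrom x Empty.elim w = some r → (∀ o, Has E s (ρ o) (Sum.elim x w o)) →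
        Spec E s (Prog.call T ρ) r.cost fun a t =>
          a.1 = r.out ∧ ∀ o, Has E t (a.2 o) (r.value o) := by
  have update : ∀ {w : ℕ → K} {s t : Mem K} {ρ : ι' ⊕ ℕ → ι ⊕ ℕ} {o : ι ⊕ ℕ} {c : K} {dst : ℕ},
      (∀ o, Has E s (ρ o) (Sum.elim x w o)) → s ≤ t → Has E t o c →
      ∀ o', Has E t (Sum.elim (ρ ∘ .inl) (Function.update (ρ ∘ .inr) dst o) o')
        (Sum.elim x (Function.update w dst c) o') := by
    intro w s t ρ o c dst hρ hst ho o'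
    cases o' with
    | inl i => exact (hρ (.inl i)).mono hst
    | inr j =>
      by_cases hj : j = dst
      · subst hj; simpa using ho
      · simpa [Function.update_of_ne hj] using (hρ (.inr j)).mono hst
  have of_map : ∀ {o : Option (Outcome K ι' O)} {r : Outcome K ι' O},
      o.map (Outcome.charge 1) = some r → ∃ r', o = some r' ∧ r.cost = r'.cost + 1 ∧
        r.value = r'.value ∧ r.out = r'.out := by
    intro o r h
    obtain ⟨r', h1, rfl⟩ := Option.map_eq_some_iff.1 h
    exact ⟨r', h1, rfl, rfl, rfl⟩
  induction T with
  | halt out =>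
    intro w s ρ r hr hρ
    simp only [CompTree.runFrom, Option.some.injEq] at hr
    subst hr
    exact (Spec.pure ⟨rfl, hρ⟩).mono (by simp) fun _ _ _ h => h
  | const dst c next ih =>
    intro w s ρ r hr hρ
    exact ((Spec.const c).bind fun o t hst ho => ih _ t _ r hr (update hρ hst ho)).mono
      (by simp) fun _ _ _ h => h
  | arith op dst a b next ih =>
    intro w s ρ r hr hρ
    simp only [CompTree.runFrom] at hr
    cases hv : op.eval (Sum.elim x w a) (Sum.elim x w b) with
    | none => simp [hv] at hr
    | some v =>
      simp only [hv, Option.bind_some] at hr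
      obtain ⟨r', hr', hc, hval, hout⟩ := of_map hr
      rw [hc, hval, hout]
      exact ((Spec.arith (hρ a) (hρ b) hv).bind fun o t hst ho =>
        ih _ t _ r' hr' (update hρ hst ho)).mono (by push_cast; linarith) fun _ _ _ h => h
  | ifZero a yes no ihy ihn =>
    intro w s ρ r hr hρ
    simp only [CompTree.runFrom] at hr
    obtain ⟨r', hr', hc, hval, hout⟩ := of_map hr
    rw [hc, hval, hout]
    refine (Spec.ifZero (b := r'.cost) (hρ a) (fun h0 => ihy w s ρ r' ?_ hρ)
      (fun h0 => ihn w s ρ r' ?_ hρ)).mono (by push_cast; linarith) fun _ _ _ h => h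
    · simpa [h0] using hr'
    · simpa [h0] using hr'
  | query q => exact q.elim

end Programs

/-! ### Products of matrices, restricted to sets of rows and columns -/

section Products

variable {K : Type u} [Field K] {ι Q : Type}

theorem sum_getElem?_elim {J M : Type*} [AddCommMonoid M] (F : J → M) :
    ∀ (l : List J) (n : ℕ), l.length ≤ n →
      ∑ v : Fin n, (l[(v : ℕ)]?).elim 0 F = (l.map F).sum
  | [], n, _ => by simp
  | j :: l, 0, h => by simp at h
  | j :: l, n + 1, h => by
    rw [Fin.sum_univ_succ]
    simp [sum_getElem?_elim F l n (by simpa using h)]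

theorem exists_getElem?_toList {I : Type*} (S : Finset I) {n : ℕ} (hn : S.card ≤ n) {i : I}
    (hi : i ∈ S) : ∃ u : Fin n, S.toList[(u : ℕ)]? = some i := by
  obtain ⟨u, hu, h⟩ := List.mem_iff_getElem.1 (Finset.mem_toList.2 hi)
  rw [Finset.length_toList] at hu
  exact ⟨⟨u, hu.trans_le hn⟩, List.getElem?_eq_some_iff.2 ⟨_, h⟩⟩

open Classical in
/-- Matrices whose rows and columns are indexed by at most `n` elements are multiplied by padding
them with zeros. -/
theorem exists_mul_block {ω c : ℝ} (h : MatMulIn K ω c) (n : ℕ) (I J L : Type) :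
    ∃ p : Finset I → Finset J → Finset L → (I → J → ι ⊕ ℕ) → (J → L → ι ⊕ ℕ) →
        Prog K ι Q (I → L → ι ⊕ ℕ),
      ∀ SI SJ SL, SI.card ≤ n → SJ.card ≤ n → SL.card ≤ n →
        ∀ (E : Env K ι Q) (s : Mem K) a b (A : I → J → K) (B : J → L → K),
          (∀ i ∈ SI, ∀ j ∈ SJ, Has E s (a i j) (A i j)) →
          (∀ j ∈ SJ, ∀ l ∈ SL, Has E s (b j l) (B j l)) →
          Spec E s (p SI SJ SL a b) (c * (n : ℝ) ^ ω) fun o t =>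
            ∀ i ∈ SI, ∀ l ∈ SL, Has E t (o i l) (∑ j ∈ SJ, A i j * B j l) := by
  obtain ⟨T, hT⟩ := h n
  refine ⟨fun SI SJ SL a b => Prog.const 0 >>= fun z =>
    Prog.call T (Sum.elim (Sum.elim
      (fun uv => (SI.toList[(uv.1 : ℕ)]?).elim z fun i => (SJ.toList[(uv.2 : ℕ)]?).elim z (a i))
      (fun uv => (SJ.toList[(uv.1 : ℕ)]?).elim z fun j => (SL.toList[(uv.2 : ℕ)]?).elim z (b j)))
      fun _ => z) >>= fun r => pure fun i l =>
        if h : ∃ u v : Fin n, SI.toList[(u : ℕ)]? = some i ∧ SL.toList[(v : ℕ)]? = some l then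
          r.2 (r.1 h.choose h.choose_spec.choose) else .inr 0, ?_⟩
  intro SI SJ SL hI hJ hL E s a b A B hA hB
  set A' : Matrix (Fin n) (Fin n) K := fun u v =>
    (SI.toList[(u : ℕ)]?).elim 0 fun i => (SJ.toList[(v : ℕ)]?).elim 0 (A i) with hA'
  set B' : Matrix (Fin n) (Fin n) K := fun u v =>
    (SJ.toList[(u : ℕ)]?).elim 0 fun j => (SL.toList[(v : ℕ)]?).elim 0 (B j) with hB'
  obtain ⟨r, hr, hcost, hout⟩ := hT A' B'
  have mem : ∀ {I : Type} {S : Finset I} {k : ℕ} {i : I}, S.toList[k]? = some i → i ∈ S :=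
    fun h => Finset.mem_toList.1 (List.mem_of_getElem? h)
  refine ((Spec.const 0).bind fun z t hst hz =>
    ((Spec.call (matMulInput A' B') T _ t _ r hr ?_).bind (b' := 0)
      fun o t' htt' ho => Spec.pure ?_)).mono (by simpa using hcost) fun _ _ _ h => h
  · rintro ((⟨u, v⟩ | ⟨u, v⟩) | k)
    · cases hu : SI.toList[(u : ℕ)]? with
      | none => simpa [matMulInput, hA', hu] using hz
      | some i =>
        cases hv : SJ.toList[(v : ℕ)]? with
        | none => simpa [matMulInput, hA', hu, hv] using hz
        | some j => simpa [matMulInput, hA', hu, hv] using (hA i (mem hu) j (mem hv)).mono hst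
    · cases hu : SJ.toList[(u : ℕ)]? with
      | none => simpa [matMulInput, hB', hu] using hz
      | some i =>
        cases hv : SL.toList[(v : ℕ)]? with
        | none => simpa [matMulInput, hB', hu, hv] using hz
        | some j => simpa [matMulInput, hB', hu, hv] using (hB i (mem hu) j (mem hv)).mono hst
    · exact hz
  · intro i hi l hl
    have hex : ∃ u v : Fin n, SI.toList[(u : ℕ)]? = some i ∧ SL.toList[(v : ℕ)]? = some l := by
      obtain ⟨u, hu⟩ := exists_getElem?_toList SI hI hi
      obtain ⟨v, hv⟩ := exists_getElem?_toList SL hL hl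
      exact ⟨u, v, hu, hv⟩
    have key : ∀ u v : Fin n, SI.toList[(u : ℕ)]? = some i → SL.toList[(v : ℕ)]? = some l →
        Has E t' (o.2 (o.1 u v)) (∑ j ∈ SJ, A i j * B j l) := by
      intro u v hu hv
      rw [ho.1]
      convert ho.2 _
      rw [hout, Matrix.mul_apply, ← Finset.sum_map_toList SJ, ← sum_getElem?_elim _ _ n
        (by rwa [Finset.length_toList])]
      refine Finset.sum_congr rfl fun k _ => ?_
      simp only [hA', hB', hu, hv, Option.elim_some]
      cases SJ.toList[(k : ℕ)]? <;> simp
    beta_reduce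
    rw [dif_pos hex]
    exact key _ _ hex.choose_spec.choose_spec.1 hex.choose_spec.choose_spec.2

theorem exists_subset_card_le_sdiff {I : Type*} [DecidableEq I] (S : Finset I) {n q : ℕ}
    (h : S.card ≤ (q + 1) * n) : ∃ S' ⊆ S, S'.card ≤ n ∧ (S \ S').card ≤ q * n := by
  obtain ⟨S', h1, h2⟩ := Finset.exists_subset_card_eq (min_le_left S.card n)
  refine ⟨S', h1, h2 ▸ min_le_right _ _, ?_⟩
  rw [Finset.card_sdiff_of_subset h1, h2]
  rw [add_mul] at h
  omega

open Classical in
/-- Products with up to `q * n` columns in the right factor. -/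
theorem exists_mul_columns {ω c : ℝ} (h : MatMulIn K ω c) (n q : ℕ) (I J L : Type) :
    ∃ p : Finset I → Finset J → Finset L → (I → J → ι ⊕ ℕ) → (J → L → ι ⊕ ℕ) →
        Prog K ι Q (I → L → ι ⊕ ℕ),
      ∀ SI SJ SL, SI.card ≤ n → SJ.card ≤ n → SL.card ≤ q * n →
        ∀ (E : Env K ι Q) (s : Mem K) a b (A : I → J → K) (B : J → L → K),
          (∀ i ∈ SI, ∀ j ∈ SJ, Has E s (a i j) (A i j)) →
          (∀ j ∈ SJ, ∀ l ∈ SL, Has E s (b j l) (B j l)) →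
          Spec E s (p SI SJ SL a b) (q * (c * (n : ℝ) ^ ω)) fun o t =>
            ∀ i ∈ SI, ∀ l ∈ SL, Has E t (o i l) (∑ j ∈ SJ, A i j * B j l) := by
  induction q with
  | zero =>
    refine ⟨fun _ _ _ _ _ => pure fun _ _ => .inr 0, ?_⟩
    intro SI SJ SL _ _ hL E s a b A B _ _
    have : SL = ∅ := by simpa using hL
    subst this
    exact (Spec.pure (by simp)).mono (by simp) fun _ _ _ h => h
  | succ q ih =>
    obtain ⟨p, hp⟩ := ih
    obtain ⟨p₁, hp₁⟩ := exists_mul_block (ι := ι) (Q := Q) h n I J L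
    refine ⟨fun SI SJ SL a b =>
      if h : SL.card ≤ (q + 1) * n then
        p₁ SI SJ (exists_subset_card_le_sdiff SL h).choose a b >>= fun o₁ =>
        p SI SJ (SL \ (exists_subset_card_le_sdiff SL h).choose) a b >>= fun o₂ =>
        pure fun i l => if l ∈ (exists_subset_card_le_sdiff SL h).choose then o₁ i l else o₂ i l
      else pure fun _ _ => .inr 0, ?_⟩
    intro SI SJ SL hI hJ hL E s a b A B hA hB
    beta_reduce
    rw [dif_pos hL]
    obtain ⟨h1, h2, h3⟩ := (exists_subset_card_le_sdiff SL hL).choose_spec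
    set S' := (exists_subset_card_le_sdiff SL hL).choose
    refine ((hp₁ SI SJ S' hI hJ h2 E s a b A B hA fun j hj l hl => hB j hj l (h1 hl)).bind
      fun o₁ t hst ho₁ => (hp SI SJ (SL \ S') hI hJ h3 E t a b A B
        (fun i hi j hj => (hA i hi j hj).mono hst)
        fun j hj l hl => (hB j hj l (Finset.mem_sdiff.1 hl).1).mono hst).bind (b' := 0)
        fun o₂ t' htt' ho₂ => Spec.pure ?_).mono (by push_cast; linarith) fun _ _ _ h => h
    intro i hi l hl
    beta_reduce
    split_ifs with hl'
    · exact (ho₁ i hi l hl').mono htt'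
    · exact ho₂ i hi l (Finset.mem_sdiff.2 ⟨hl, hl'⟩)

open Classical in
/-- Products with up to `q' * n` rows in the left factor and up to `q * n` columns in the right
factor. -/
theorem exists_mul {ω c : ℝ} (h : MatMulIn K ω c) (n q' q : ℕ) (I J L : Type) :
    ∃ p : Finset I → Finset J → Finset L → (I → J → ι ⊕ ℕ) → (J → L → ι ⊕ ℕ) →
        Prog K ι Q (I → L → ι ⊕ ℕ),
      ∀ SI SJ SL, SI.card ≤ q' * n → SJ.card ≤ n → SL.card ≤ q * n →
        ∀ (E : Env K ι Q) (s : Mem K) a b (A : I → J → K) (B : J → L → K),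
          (∀ i ∈ SI, ∀ j ∈ SJ, Has E s (a i j) (A i j)) →
          (∀ j ∈ SJ, ∀ l ∈ SL, Has E s (b j l) (B j l)) →
          Spec E s (p SI SJ SL a b) (q' * (q * (c * (n : ℝ) ^ ω))) fun o t =>
            ∀ i ∈ SI, ∀ l ∈ SL, Has E t (o i l) (∑ j ∈ SJ, A i j * B j l) := by
  induction q' with
  | zero =>
    refine ⟨fun _ _ _ _ _ => pure fun _ _ => .inr 0, ?_⟩
    intro SI SJ SL hI _ _ E s a b A B _ _
    have : SI = ∅ := by simpa using hI
    subst this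
    exact (Spec.pure (by simp)).mono (by simp) fun _ _ _ h => h
  | succ q' ih =>
    obtain ⟨p, hp⟩ := ih
    obtain ⟨p₁, hp₁⟩ := exists_mul_columns (ι := ι) (Q := Q) h n q I J L
    refine ⟨fun SI SJ SL a b =>
      if h : SI.card ≤ (q' + 1) * n then
        p₁ (exists_subset_card_le_sdiff SI h).choose SJ SL a b >>= fun o₁ =>
        p (SI \ (exists_subset_card_le_sdiff SI h).choose) SJ SL a b >>= fun o₂ =>
        pure fun i l => if i ∈ (exists_subset_card_le_sdiff SI h).choose then o₁ i l else o₂ i l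
      else pure fun _ _ => .inr 0, ?_⟩
    intro SI SJ SL hI hJ hL E s a b A B hA hB
    beta_reduce
    rw [dif_pos hI]
    obtain ⟨h1, h2, h3⟩ := (exists_subset_card_le_sdiff SI hI).choose_spec
    set S' := (exists_subset_card_le_sdiff SI hI).choose
    refine ((hp₁ S' SJ SL h2 hJ hL E s a b A B (fun i hi j hj => hA i (h1 hi) j hj) hB).bind
      fun o₁ t hst ho₁ => (hp (SI \ S') SJ SL h3 hJ hL E t a b A B
        (fun i hi j hj => (hA i (Finset.mem_sdiff.1 hi).1 j hj).mono hst)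
        fun j hj l hl => (hB j hj l hl).mono hst).bind (b' := 0)
        fun o₂ t' htt' ho₂ => Spec.pure ?_).mono (by push_cast; linarith) fun _ _ _ h => h
    intro i hi l hl
    beta_reduce
    split_ifs with hi'
    · exact (ho₁ i hi' l hl).mono htt'
    · exact ho₂ i (Finset.mem_sdiff.2 ⟨hi, hi'⟩) l hl

/-- An arithmetic operation applied entry by entry. -/
noncomputable def Prog.zipWith {I J : Type} (op : ArithOp) (SI : Finset I) (SJ : Finset J)
    (a b : I → J → ι ⊕ ℕ) : Prog K ι Q (I → J → ι ⊕ ℕ) :=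
  letI : Inhabited (ι ⊕ ℕ) := ⟨.inr 0⟩
  Prog.forEach (fun ij : I × J => Prog.arith op (a ij.1 ij.2) (b ij.1 ij.2)) (SI ×ˢ SJ).toList >>=
    fun g => pure fun i j => g (i, j)

theorem Spec.zipWith {I J : Type} {op : ArithOp} {f : K → K → K}
    (hop : ∀ u v, op.eval u v = some (f u v)) {SI : Finset I} {SJ : Finset J} {E : Env K ι Q}
    {s : Mem K} {a b : I → J → ι ⊕ ℕ} {A B : I → J → K}
    (hA : ∀ i ∈ SI, ∀ j ∈ SJ, Has E s (a i j) (A i j))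
    (hB : ∀ i ∈ SI, ∀ j ∈ SJ, Has E s (b i j) (B i j)) :
    Spec E s (Prog.zipWith op SI SJ a b) (SI.card * SJ.card) fun o t =>
      ∀ i ∈ SI, ∀ j ∈ SJ, Has E t (o i j) (f (A i j) (B i j)) := by
  let _ : Inhabited (ι ⊕ ℕ) := ⟨.inr 0⟩
  refine ((Spec.forEach (b := 1)
    (P := fun (ij : I × J) (o : ι ⊕ ℕ) t => Has E t o (f (A ij.1 ij.2) (B ij.1 ij.2)))
    (fun _ _ _ _ htt' h => h.mono htt') (SI ×ˢ SJ) ?_).bind (b' := 0)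
    fun g t hst hg => Spec.pure (Post := fun (o : I → J → ι ⊕ ℕ) t =>
      ∀ i ∈ SI, ∀ j ∈ SJ, Has E t (o i j) (f (A i j) (B i j)))
      fun i hi j hj => hg (i, j) (Finset.mem_product.2 ⟨hi, hj⟩)).mono
      (by rw [Finset.card_product]; push_cast; linarith) fun _ _ _ h => h
  rintro ⟨i, j⟩ hij t hst
  obtain ⟨hi, hj⟩ := Finset.mem_product.1 hij
  exact Spec.arith ((hA i hi j hj).mono hst) ((hB i hi j hj).mono hst) (hop _ _)

end Products

/-! ### Row rank profiles and generalized inverses -/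

section Pivot

variable {K : Type u} [Field K] {N D : ℕ}

/-- The rows `P` of `A` are those rows with index in `R` that are not combinations of earlier rows
with index in `R`; the submatrix of `A` with rows `P` and columns `Q` is invertible, and `W` is its
inverse, padded with zeros. This is encoded by equations: `W` is a generalized inverse, `A * W`
gives the coefficients of the rows in terms of the rows `P`, and these are lower triangular. -/
structure IsPivot (A : Matrix (Fin N) (Fin D) K) (R P : Finset (Fin N)) (Q : Finset (Fin D))
    (W : Matrix (Fin D) (Fin N) K) : Prop where
  rows_subset : P ⊆ R
  card_le : Q.card ≤ R.card
  support : ∀ q p, ¬ (q ∈ Q ∧ p ∈ P) → W q p = 0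
  inverse : ∀ p ∈ P, ∀ p' ∈ P, (A * W) p p' = (1 : Matrix (Fin N) (Fin N) K) p p'
  reproduces : ∀ i ∈ R, (A * W * A) i = A i
  triangular : ∀ i ∈ R, ∀ p ∈ P, i < p → (A * W) i p = 0

theorem sum_eq_mul_apply {I J L : Type*} [Fintype J] {A : Matrix I J K} {B : Matrix J L K}
    {S : Finset J} {i : I} {l : L} (h : ∀ j ∉ S, A i j * B j l = 0) :
    ∑ j ∈ S, A i j * B j l = (A * B) i l := by
  rw [Matrix.mul_apply]
  exact Finset.sum_subset (Finset.subset_univ _) fun j _ hj => h j hj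

namespace IsPivot

variable {A : Matrix (Fin N) (Fin D) K} {R P : Finset (Fin N)} {Q : Finset (Fin D)}
  {W : Matrix (Fin D) (Fin N) K}

theorem mul_apply_eq_zero (h : IsPivot A R P Q W) {M : Type*} (X : Matrix M (Fin D) K) (i : M)
    {p : Fin N} (hp : p ∉ P) : (X * W) i p = 0 := by
  rw [Matrix.mul_apply]
  exact Finset.sum_eq_zero fun q _ => by rw [h.support q p fun h' => hp h'.2, mul_zero]

theorem row_card_le (h : IsPivot A R P Q W) : P.card ≤ Q.card := by
  have h1 : A.submatrix (fun p : P => (p : Fin N)) (fun q : Q => (q : Fin D)) *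
      W.submatrix (fun q : Q => (q : Fin D)) (fun p : P => (p : Fin N)) = 1 := by
    ext p p'
    rw [Matrix.mul_apply]
    simp only [Matrix.submatrix_apply]
    rw [Finset.sum_coe_sort Q fun q => A p q * W q p', sum_eq_mul_apply, h.inverse _ p.2 _ p'.2]
    · simp only [Matrix.one_apply, Subtype.coe_inj]
    · intro j hj
      rw [h.support j p' fun h' => hj h'.1, mul_zero]
  have h2 := Matrix.rank_mul_le_left
    (A.submatrix (fun p : P => (p : Fin N)) (fun q : Q => (q : Fin D)))
    (W.submatrix (fun q : Q => (q : Fin D)) (fun p : P => (p : Fin N)))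
  rw [h1, Matrix.rank_one] at h2
  have h3 := h2.trans (Matrix.rank_le_card_width _)
  simpa using h3

/-- The Schur complement formula: pivots of the rows `R₁` of `A`, and of the rows `R₂` of what is
left of `A` after elimination with the first pivots, combine to pivots of `A`. -/
theorem merge {R₁ P₁ R₂ P₂ : Finset (Fin N)} {Q₁ Q₂ : Finset (Fin D)}
    {W₁ W₂ Z : Matrix (Fin D) (Fin N) K} (h₁ : IsPivot A R₁ P₁ Q₁ W₁)
    (h₂ : IsPivot (A - A * W₁ * A) R₂ P₂ Q₂ W₂) (hlt : ∀ i ∈ R₁, ∀ j ∈ R₂, i < j)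
    (hZ : Z = W₂ - W₂ * (A * W₁)) :
    IsPivot A (R₁ ∪ R₂) (P₁ ∪ P₂) (Q₁ ∪ Q₂) (W₁ + Z - W₁ * A * Z) := by
  classical
  set Y := A - A * W₁ * A with hY
  set G := Y * W₂ with hG
  have hdisj : Disjoint R₁ R₂ := by
    rw [Finset.disjoint_left]
    exact fun i hi hi' => lt_irrefl i (hlt i hi i hi')
  have hAW : A * (W₁ + Z - W₁ * A * Z) = A * W₁ + G - G * (A * W₁) := by
    rw [hZ, hG, hY]
    simp only [Matrix.mul_add, Matrix.mul_sub, Matrix.sub_mul, Matrix.mul_assoc]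
    abel
  have hG0 : ∀ i p, p ∉ P₂ → G i p = 0 := fun i p hp => h₂.mul_apply_eq_zero Y i hp
  have hY1 : ∀ i ∈ R₁, Y i = 0 := fun i hi => by
    rw [hY]; funext j
    have := congrFun (h₁.reproduces i hi) j
    simp [this]
  have hG1 : ∀ i ∈ R₁, G i = 0 := fun i hi => by
    rw [hG, Matrix.mul_apply_eq_vecMul, hY1 i hi, Matrix.zero_vecMul]
  have hrow1 : ∀ i ∈ R₁, (A * (W₁ + Z - W₁ * A * Z)) i = (A * W₁) i := fun i hi => by
    have : (G * (A * W₁)) i = 0 := by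
      rw [Matrix.mul_apply_eq_vecMul, hG1 i hi, Matrix.zero_vecMul]
    rw [hAW]; funext j
    simp [congrFun this j, congrFun (hG1 i hi) j]
  have hAWA : A * (W₁ + Z - W₁ * A * Z) * A = A * W₁ * A + G * Y := by
    rw [hAW, hY]
    simp only [Matrix.mul_sub, Matrix.add_mul, Matrix.sub_mul, Matrix.mul_assoc]
    abel
  have hP₁ : ∀ p ∈ P₂, p ∉ P₁ := fun p hp hp' =>
    Finset.disjoint_left.1 hdisj (h₁.rows_subset hp') (h₂.rows_subset hp)
  have hsuppZ : ∀ q p, ¬ (q ∈ Q₂ ∧ p ∈ P₁ ∪ P₂) → Z q p = 0 := by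
    intro q p hqp
    rw [hZ, Matrix.sub_apply]
    by_cases hq : q ∈ Q₂
    · have hp : p ∉ P₁ ∧ p ∉ P₂ := by simpa [hq] using hqp
      rw [h₂.support q p fun h' => hp.2 h'.2, ← Matrix.mul_assoc, h₁.mul_apply_eq_zero _ _ hp.1,
        sub_zero]
    · have : W₂ q = 0 := by
        funext p'
        exact h₂.support q p' fun h' => hq h'.1
      rw [Matrix.mul_apply_eq_vecMul, this]
      simp
  refine ⟨Finset.union_subset_union h₁.rows_subset h₂.rows_subset, ?_, ?_, ?_, ?_, ?_⟩
  · rw [Finset.card_union_of_disjoint hdisj]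
    exact (Finset.card_union_le _ _).trans (add_le_add h₁.card_le h₂.card_le)
  · intro q p hqp
    have hW1 : W₁ q p = 0 := h₁.support q p fun h' =>
      hqp ⟨Finset.mem_union_left _ h'.1, Finset.mem_union_left _ h'.2⟩
    have hZ1 : Z q p = 0 := hsuppZ q p fun h' => hqp ⟨Finset.mem_union_right _ h'.1, h'.2⟩
    have hT : (W₁ * A * Z) q p = 0 := by
      by_cases hq : q ∈ Q₁
      · rw [Matrix.mul_apply]
        refine Finset.sum_eq_zero fun q' _ => ?_
        rw [hsuppZ q' p fun h' => hqp ⟨Finset.mem_union_left _ hq, h'.2⟩, mul_zero]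
      · have : W₁ q = 0 := by
          funext p'
          exact h₁.support q p' fun h' => hq h'.1
        rw [Matrix.mul_assoc, Matrix.mul_apply_eq_vecMul, this]
        simp
    simp [hW1, hZ1, hT]
  · intro p hp p' hp'
    rcases Finset.mem_union.1 hp with hp | hp
    · rw [hrow1 p (h₁.rows_subset hp)]
      rcases Finset.mem_union.1 hp' with hp' | hp'
      · exact h₁.inverse p hp p' hp'
      · rw [h₁.mul_apply_eq_zero _ _ (hP₁ p' hp'), Matrix.one_apply_ne]
        rintro rfl
        exact hP₁ _ hp' hp
    · have hGp : G p = (1 : Matrix (Fin N) (Fin N) K) p := by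
        funext j
        by_cases hj : j ∈ P₂
        · exact h₂.inverse p hp j hj
        · rw [hG0 p j hj, Matrix.one_apply_ne]
          rintro rfl
          exact hj hp
      have : (G * (A * W₁)) p = (A * W₁) p := by
        rw [Matrix.mul_apply_eq_vecMul, hGp, ← Matrix.mul_apply_eq_vecMul, Matrix.one_mul]
      rw [hAW]
      simp [congrFun this p', hGp]
  · intro i hi
    rw [hAWA]
    rcases Finset.mem_union.1 hi with hi | hi
    · have : (G * Y) i = 0 := by rw [Matrix.mul_apply_eq_vecMul, hG1 i hi, Matrix.zero_vecMul]
      funext j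
      simp [congrFun this j, h₁.reproduces i hi]
    · funext j
      rw [Matrix.add_apply, congrFun (h₂.reproduces i hi) j, hY]
      simp
  · intro i hi p hp hip
    rcases Finset.mem_union.1 hi with hi | hi
    · rw [hrow1 i hi]
      rcases Finset.mem_union.1 hp with hp | hp
      · exact h₁.triangular i hi p hp hip
      · exact h₁.mul_apply_eq_zero _ _ (hP₁ p hp)
    · rcases Finset.mem_union.1 hp with hp | hp
      · exact absurd hip (hlt p (h₁.rows_subset hp) i hi).asymm
      · rw [hAW, Matrix.sub_apply, Matrix.add_apply, h₁.mul_apply_eq_zero _ _ (hP₁ p hp),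
          ← Matrix.mul_assoc, h₁.mul_apply_eq_zero _ _ (hP₁ p hp)]
        simpa using h₂.triangular i hi p hp hip

/-- Zero rows have no pivots. -/
theorem of_row_eq_zero {R : Finset (Fin N)} (h : ∀ i ∈ R, A i = 0) :
    IsPivot A R ∅ ∅ (0 : Matrix (Fin D) (Fin N) K) :=
  ⟨by simp, by simp, by simp, by simp, fun i hi => by
    rw [Matrix.mul_zero, Matrix.zero_mul, h i hi]; rfl, by simp⟩

/-- Any nonzero entry of a single row is a pivot. -/
theorem of_entry_ne_zero {i : Fin N} {j : Fin D} (h : A i j ≠ 0) :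
    IsPivot A {i} {i} {j} (Matrix.single j i (1 / A i j)) := by
  have hi : (A * Matrix.single j i (1 / A i j)) i = (1 : Matrix (Fin N) (Fin N) K) i := by
    funext p
    rw [Matrix.mul_apply, Finset.sum_eq_single j (by
      intro b _ hb; rw [Matrix.single_apply_of_row_ne hb.symm, mul_zero]) (by simp)]
    by_cases hp : i = p
    · subst hp; simp [h]
    · rw [Matrix.single_apply_of_col_ne _ _ hp, Matrix.one_apply_ne hp, mul_zero]
  refine ⟨subset_rfl, by simp, ?_, ?_, ?_, ?_⟩
  · intro q p hqp
    rw [Matrix.single_apply, if_neg]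
    rintro ⟨rfl, rfl⟩
    simp at hqp
  · intro p hp p' _
    rw [Finset.mem_singleton.1 hp, hi]
  · intro p hp
    rw [Finset.mem_singleton.1 hp, Matrix.mul_apply_eq_vecMul, hi, ← Matrix.mul_apply_eq_vecMul,
      Matrix.one_mul]
  · intro p hp p' hp' hlt
    rw [Finset.mem_singleton.1 hp, Finset.mem_singleton.1 hp'] at hlt
    exact absurd hlt (lt_irrefl _)

end IsPivot

end Pivot

/-! ### Computing pivots -/

section PivotPrograms

variable {K : Type u} [Field K] {ι Q : Type} {N D : ℕ}

/-- The result of a pivot computation: row indices, column indices, and the places of the entries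
of the generalized inverse. -/
abbrev PivotOut (ι : Type) (N D : ℕ) : Type :=
  Finset (Fin N) × Finset (Fin D) × (Fin D → Fin N → ι ⊕ ℕ)

/-- The result `o` describes pivots of the rows `R` of `A`. -/
def PivotFound (E : Env K ι Q) (A : Matrix (Fin N) (Fin D) K) (R : Finset (Fin N))
    (o : PivotOut ι N D) (t : Mem K) : Prop :=
  ∃ W, IsPivot A R o.1 o.2.1 W ∧ ∀ q ∈ o.2.1, ∀ p ∈ o.1, Has E t (o.2.2 q p) (W q p)

/-- The program `p` finds pivots of the rows `R` of any matrix, with at most `b` operations. -/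
def FindsPivots (p : (Fin N → Fin D → ι ⊕ ℕ) → Prog K ι Q (PivotOut ι N D)) (R : Finset (Fin N))
    (b : ℝ) : Prop :=
  ∀ (E : Env K ι Q) (s : Mem K) (a : Fin N → Fin D → ι ⊕ ℕ) (A : Matrix (Fin N) (Fin D) K),
    (∀ i ∈ R, ∀ j, Has E s (a i j) (A i j)) → Spec E s (p a) b (PivotFound E A R)

theorem FindsPivots.mono {p : (Fin N → Fin D → ι ⊕ ℕ) → Prog K ι Q (PivotOut ι N D)}
    {R : Finset (Fin N)} {b b' : ℝ} (h : FindsPivots p R b) (hb : b ≤ b') : FindsPivots p R b' :=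
  fun E s a A hA => (h E s a A hA).mono hb fun _ _ _ h => h

/-- A bound, in units of `q * n ^ ω`, on the cost of eliminating at most `n` rows with at most
`q * n` columns by means of at most `n` known pivots, and of merging pivots. -/
def mergeConst (c : ℝ) : ℝ := 6 * |c| + 11

theorem sq_le_rpow {ω : ℝ} (hω : 2 < ω) (n : ℕ) : (n : ℝ) * n ≤ (n : ℝ) ^ ω := by
  rcases Nat.eq_zero_or_pos n with rfl | hn
  · simpa using Real.rpow_nonneg le_rfl ω
  · have : (1 : ℝ) ≤ n := by exact_mod_cast hn
    calc (n : ℝ) * n = (n : ℝ) ^ (2 : ℝ) := by rw [Real.rpow_two, sq]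
      _ ≤ _ := Real.rpow_le_rpow_of_exponent_le this hω.le

/-- The merge step as a program: it forms the Schur complement of the second block of rows, finds
the pivots of the complement with the given program, and assembles the generalized inverse. -/
theorem exists_merge {ω c : ℝ} (hω : 2 < ω) (h : MatMulIn K ω c) (N D n q : ℕ) (hq : 1 ≤ q)
    (hD : D ≤ q * n) :
    ∃ p : (Fin N → Fin D → ι ⊕ ℕ) → PivotOut ι N D → Finset (Fin N) →
        ((Fin N → Fin D → ι ⊕ ℕ) → Prog K ι Q (PivotOut ι N D)) → Prog K ι Q (PivotOut ι N D),
      ∀ (E : Env K ι Q) (s : Mem K) a (A : Matrix (Fin N) (Fin D) K) (o₁ : PivotOut ι N D)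
        (R₁ R₂ : Finset (Fin N)) p₂ (b₂ : ℝ), (∀ i ∈ R₁ ∪ R₂, ∀ j, Has E s (a i j) (A i j)) →
        PivotFound E A R₁ o₁ s → (∀ i ∈ R₁, ∀ j ∈ R₂, i < j) → o₁.2.1.card ≤ n →
        R₂.card ≤ n → FindsPivots p₂ R₂ b₂ →
        Spec E s (p a o₁ R₂ p₂) (b₂ + q * (mergeConst c * (n : ℝ) ^ ω))
          (PivotFound E A (R₁ ∪ R₂)) := by
  classical
  obtain ⟨mulT, hmulT⟩ := exists_mul (ι := ι) (Q := Q) h n 1 q (Fin D) (Fin N) (Fin D)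
  obtain ⟨mulS, hmulS⟩ := exists_mul (ι := ι) (Q := Q) h n 1 q (Fin N) (Fin D) (Fin D)
  obtain ⟨mulX, hmulX⟩ := exists_mul (ι := ι) (Q := Q) h n 1 1 (Fin N) (Fin D) (Fin N)
  obtain ⟨mulX', hmulX'⟩ := exists_mul (ι := ι) (Q := Q) h n 1 1 (Fin D) (Fin N) (Fin N)
  obtain ⟨mulU, hmulU⟩ := exists_mul (ι := ι) (Q := Q) h n 1 2 (Fin D) (Fin D) (Fin N)
  refine ⟨fun a o₁ R₂ p₂ => Prog.const 0 >>= fun z =>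
    mulT o₁.2.1 o₁.1 Finset.univ o₁.2.2 a >>= fun T =>
    mulS R₂ o₁.2.1 Finset.univ a T >>= fun S =>
    Prog.zipWith .sub R₂ Finset.univ a S >>= fun y =>
    p₂ y >>= fun o₂ =>
    mulX o₂.1 o₁.2.1 o₁.1 a o₁.2.2 >>= fun X =>
    mulX' o₂.2.1 o₂.1 o₁.1 o₂.2.2 X >>= fun X' =>
    Prog.zipWith .sub o₂.2.1 (o₁.1 ∪ o₂.1) (fun q p => if p ∈ o₂.1 then o₂.2.2 q p else z)
      (fun q p => if p ∈ o₁.1 then X' q p else z) >>= fun Z =>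
    mulU o₁.2.1 o₂.2.1 (o₁.1 ∪ o₂.1) T Z >>= fun U =>
    Prog.zipWith .add (o₁.2.1 ∪ o₂.2.1) (o₁.1 ∪ o₂.1)
      (fun q p => if q ∈ o₁.2.1 ∧ p ∈ o₁.1 then o₁.2.2 q p else z)
      (fun q p => if q ∈ o₂.2.1 then Z q p else z) >>= fun V =>
    Prog.zipWith .sub (o₁.2.1 ∪ o₂.2.1) (o₁.1 ∪ o₂.1) V
      (fun q p => if q ∈ o₁.2.1 then U q p else z) >>= fun w =>
    pure (o₁.1 ∪ o₂.1, o₁.2.1 ∪ o₂.2.1, w), ?_⟩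
  rintro E s a A ⟨P₁, Q₁, w₁⟩ R₁ R₂ p₂ b₂ hA ⟨W₁, hW₁, hw₁⟩ hlt hQn hRn hp₂
  dsimp only at hW₁ hw₁ hQn ⊢
  have hPn : P₁.card ≤ n := hW₁.row_card_le.trans hQn
  have hA1 : ∀ i ∈ P₁, ∀ j, Has E s (a i j) (A i j) := fun i hi =>
    hA i (Finset.mem_union_left _ (hW₁.rows_subset hi))
  have hA2 : ∀ i ∈ R₂, ∀ j, Has E s (a i j) (A i j) := fun i hi =>
    hA i (Finset.mem_union_right _ hi)
  have hDn : (Finset.univ : Finset (Fin D)).card ≤ q * n := by simpa using hD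
  have hadd : ∀ u v : K, ArithOp.add.eval u v = some (u + v) := fun _ _ => rfl
  have hsub : ∀ u v : K, ArithOp.sub.eval u v = some (u - v) := fun _ _ => rfl
  have hT : ∀ i j, ∑ k ∈ P₁, W₁ i k * A k j = (W₁ * A) i j := fun i j =>
    sum_eq_mul_apply fun k hk => by rw [hW₁.support i k fun h' => hk h'.2, zero_mul]
  have hAW1 : ∀ i j, ∑ k ∈ Q₁, A i k * W₁ k j = (A * W₁) i j := fun i j =>
    sum_eq_mul_apply fun k hk => by rw [hW₁.support k j fun h' => hk h'.1, mul_zero]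
  have hS : ∀ i j, ∑ k ∈ Q₁, A i k * (W₁ * A) k j = (A * W₁ * A) i j := fun i j => by
    rw [Matrix.mul_assoc]
    refine sum_eq_mul_apply fun k hk => ?_
    have : W₁ k = 0 := funext fun p => hW₁.support k p fun h' => hk h'.1
    rw [Matrix.mul_apply_eq_vecMul, this, Matrix.zero_vecMul, Pi.zero_apply, mul_zero]
  refine (Spec.const 0).step fun z t₀ hs₀ hz =>
    (hmulT Q₁ P₁ Finset.univ (by simpa using hQn) hPn hDn E t₀ w₁ a W₁ A
      (fun i hi j hj => (hw₁ i hi j hj).mono hs₀) fun i hi j _ => (hA1 i hi j).mono hs₀).step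
    fun T t₁ hs₁ hT₁ => ?_
  refine (hmulS R₂ Q₁ Finset.univ (by simpa using hRn) hQn hDn E t₁ a T A (W₁ * A)
    (fun i hi j hj => (hA2 i hi j).mono (hs₀.trans hs₁)) fun i hi j hj => ?_).step
    fun S t₂ hs₂ hS₂ => ?_
  · simpa only [hT] using hT₁ i hi j hj
  simp only [hT] at hT₁
  simp only [hS] at hS₂
  refine ((Spec.zipWith (B := A * W₁ * A) hsub
    (fun i hi j _ => (hA2 i hi j).mono (hs₀.trans (hs₁.trans hs₂))) hS₂).mono
    (b' := n * (q * n)) ?_ fun _ _ _ h => h).step fun y t₃ hs₃ hy => ?_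
  · have h1 : ((Finset.univ : Finset (Fin D)).card : ℝ) ≤ q * n := by exact_mod_cast hDn
    have h2 : (R₂.card : ℝ) ≤ n := by exact_mod_cast hRn
    exact mul_le_mul h2 h1 (by positivity) (by positivity)
  refine (hp₂ E t₃ y (A - A * W₁ * A) fun i hi j => hy i hi j (Finset.mem_univ _)).step ?_
  rintro ⟨P₂, Q₂, w₂⟩ t₄ hs₄ ⟨W₂, hW₂, hw₂⟩
  dsimp only at hW₂ hw₂ ⊢
  have hQn₂ : Q₂.card ≤ n := hW₂.card_le.trans hRn
  have hPn₂ : P₂.card ≤ n := (Finset.card_le_card hW₂.rows_subset).trans hRn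
  have hPu : (P₁ ∪ P₂).card ≤ 2 * n := (Finset.card_union_le _ _).trans (by omega)
  have hQu : (Q₁ ∪ Q₂).card ≤ 2 * n := (Finset.card_union_le _ _).trans (by omega)
  have hPu' : ((P₁ ∪ P₂).card : ℝ) ≤ 2 * n := by exact_mod_cast hPu
  have hQu' : ((Q₁ ∪ Q₂).card : ℝ) ≤ 2 * n := by exact_mod_cast hQu
  have hs04 : s ≤ t₄ := hs₀.trans (hs₁.trans (hs₂.trans (hs₃.trans hs₄)))
  have hz₄ : Has E t₄ z 0 := hz.mono (hs₁.trans (hs₂.trans (hs₃.trans hs₄)))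
  have hT₄ : ∀ i ∈ Q₁, ∀ l ∈ Finset.univ, Has E t₄ (T i l) ((W₁ * A) i l) := fun i hi l hl =>
    (hT₁ i hi l hl).mono (hs₂.trans (hs₃.trans hs₄))
  refine (hmulX P₂ Q₁ P₁ (by simpa using hPn₂) hQn (by simpa using hPn) E t₄ a w₁ A W₁
    (fun i hi j _ => (hA2 i (hW₂.rows_subset hi) j).mono hs04)
    fun i hi j hj => (hw₁ i hi j hj).mono hs04).step fun X t₅ hs₅ hX => ?_
  simp only [hAW1] at hX
  refine (hmulX' Q₂ P₂ P₁ (by simpa using hQn₂) hPn₂ (by simpa using hPn) E t₅ w₂ X W₂ (A * W₁)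
    (fun i hi j hj => (hw₂ i hi j hj).mono hs₅) hX).step fun X' t₆ hs₆ hX' => ?_
  have hsumX : ∀ i j, ∑ k ∈ P₂, W₂ i k * (A * W₁) k j = (W₂ * (A * W₁)) i j := fun i j =>
    sum_eq_mul_apply fun k hk => by rw [hW₂.support i k fun h' => hk h'.2, zero_mul]
  simp only [hsumX] at hX'
  set Z₀ : Matrix (Fin D) (Fin N) K := W₂ - W₂ * (A * W₁) with hZ₀
  have hZrow : ∀ k ∉ Q₂, ∀ j, Z₀ k j = 0 := fun k hk j => by
    have : W₂ k = 0 := funext fun p => hW₂.support k p fun h' => hk h'.1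
    rw [hZ₀, Matrix.sub_apply, Matrix.mul_apply_eq_vecMul, this, Matrix.zero_vecMul]
    simp
  have hz₆ := hz₄.mono (hs₅.trans hs₆)
  refine ((Spec.zipWith (A := W₂) (B := W₂ * (A * W₁)) hsub
    (fun i hi j _ => ?_) (fun i hi j _ => ?_)).mono
    (b' := n * (2 * n)) ?_ fun _ _ _ h => h).step fun Z t₇ hs₇ hZ => ?_
  · split_ifs with hj
    · exact (hw₂ i hi j hj).mono (hs₅.trans hs₆)
    · rw [hW₂.support i j fun h' => hj h'.2]
      exact hz₆
  · split_ifs with hj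
    · exact hX' i hi j hj
    · rw [← Matrix.mul_assoc, hW₁.mul_apply_eq_zero _ _ hj]
      exact hz₆
  · have h2 : (Q₂.card : ℝ) ≤ n := by exact_mod_cast hQn₂
    exact mul_le_mul h2 hPu' (by positivity) (by positivity)
  refine (hmulU Q₁ Q₂ (P₁ ∪ P₂) (by simpa using hQn) hQn₂ hPu E t₇ T Z (W₁ * A) Z₀
    (fun i hi j hj => (hT₄ i hi j (Finset.mem_univ _)).mono (hs₅.trans (hs₆.trans hs₇)))
    hZ).step fun U t₈ hs₈ hU => ?_
  have hsumU : ∀ i j, ∑ k ∈ Q₂, (W₁ * A) i k * Z₀ k j = (W₁ * A * Z₀) i j := fun i j =>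
    sum_eq_mul_apply fun k hk => by rw [hZrow k hk, mul_zero]
  simp only [hsumU] at hU
  have hz₈ := hz₆.mono (hs₇.trans hs₈)
  refine ((Spec.zipWith (A := W₁) (B := Z₀) hadd
    (fun i hi j _ => ?_) (fun i hi j hj => ?_)).mono
    (b' := (2 * n) * (2 * n)) ?_ fun _ _ _ h => h).step fun V t₉ hs₉ hV => ?_
  · split_ifs with hj
    · exact (hw₁ i hj.1 j hj.2).mono
        (hs04.trans (hs₅.trans (hs₆.trans (hs₇.trans hs₈))))
    · rw [hW₁.support i j hj]
      exact hz₈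
  · split_ifs with hi'
    · exact (hZ i hi' j hj).mono hs₈
    · rw [hZrow i hi']
      exact hz₈
  · exact mul_le_mul hQu' hPu' (by positivity) (by positivity)
  refine ((Spec.zipWith (B := W₁ * A * Z₀) hsub hV (fun i hi j hj => ?_)).mono
    (b' := (2 * n) * (2 * n)) ?_ fun _ _ _ h => h).step fun w t₁₀ hs₁₀ hw => Spec.done ?_ ?_
  · split_ifs with hi'
    · exact (hU i hi' j hj).mono hs₉
    · have : W₁ i = 0 := funext fun p => hW₁.support i p fun h' => hi' h'.1
      rw [Matrix.mul_assoc, Matrix.mul_apply_eq_vecMul, this, Matrix.zero_vecMul]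
      exact hz₈.mono hs₉
  · exact mul_le_mul hQu' hPu' (by positivity) (by positivity)
  rotate_left
  · exact ⟨_, hW₁.merge hW₂ hlt hZ₀, hw⟩
  have h1 := sq_le_rpow hω n
  have hq' : (1 : ℝ) ≤ q := by exact_mod_cast hq
  have h0 : (0 : ℝ) ≤ (n : ℝ) ^ ω := Real.rpow_nonneg (Nat.cast_nonneg n) ω
  have hc : c * (n : ℝ) ^ ω ≤ |c| * (n : ℝ) ^ ω :=
    mul_le_mul_of_nonneg_right (le_abs_self c) h0
  have hc0 : 0 ≤ |c| * (n : ℝ) ^ ω := by positivity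
  simp only [mergeConst]
  push_cast
  generalize (n : ℝ) ^ ω = X at *
  generalize (n : ℝ) = y at *
  nlinarith [mul_le_mul_of_nonneg_left hc (by linarith : (0 : ℝ) ≤ q),
    mul_le_mul_of_nonneg_left h1 (by linarith : (0 : ℝ) ≤ q),
    mul_nonneg (sub_nonneg.2 hq') hc0, mul_nonneg (sub_nonneg.2 hq') h0]

end PivotPrograms

section PivotRecursion

variable {K : Type u} [Field K] {ι Q : Type} {N D : ℕ}

/-- Find a nonzero entry in a list of operands, if there is one. -/
def Prog.findNonzero {J : Type} (a : J → ι ⊕ ℕ) : List J → Prog K ι Q (Option J)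
  | [] => pure none
  | j :: l => Prog.ifZero (a j) (Prog.findNonzero a l) (pure (some j))

theorem Spec.findNonzero {J : Type} {E : Env K ι Q} {s : Mem K} {a : J → ι ⊕ ℕ} {v : J → K} :
    ∀ l : List J, (∀ j ∈ l, Has E s (a j) (v j)) →
      Spec E s (Prog.findNonzero a l) l.length fun o t => s = t ∧
        (o = none → ∀ j ∈ l, v j = 0) ∧ ∀ j, o = some j → v j ≠ 0
  | [], _ => Spec.done (by simp) (by simp)
  | j :: l, h => by
    refine (Spec.ifZero (b := l.length) (h j (by simp)) (fun h0 => ?_) fun h0 =>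
      Spec.done (by positivity) ⟨rfl, by simp, ?_⟩).mono (by simp) fun _ _ _ h => h
    · refine (Spec.findNonzero l fun j' hj' => h j' (by simp [hj'])).mono le_rfl
        fun o t _ ho => ⟨ho.1, ?_, ho.2.2⟩
      rintro hn j' hj'
      rcases List.mem_cons.1 hj' with rfl | hj'
      · exact h0
      · exact ho.2.1 hn j' hj'
    · rintro j' hj'
      obtain rfl : j = j' := by simpa using hj'
      exact h0

theorem exists_pivots_card_le_one (N D : ℕ) :
    ∃ p : Finset (Fin N) → (Fin N → Fin D → ι ⊕ ℕ) → Prog K ι Q (PivotOut ι N D),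
      ∀ R : Finset (Fin N), R.card ≤ 1 → FindsPivots (p R) R (D + 1) := by
  classical
  refine ⟨fun R a => if h : R.Nonempty then
      Prog.findNonzero (a h.choose) (List.finRange D) >>= fun o =>
        match o with
        | none => pure (∅, ∅, fun _ _ => .inr 0)
        | some j => Prog.const 1 >>= fun e => Prog.arith .div e (a h.choose j) >>= fun w =>
            pure ({h.choose}, {j}, fun _ _ => w)
    else pure (∅, ∅, fun _ _ => .inr 0), ?_⟩
  intro R hR E s a A hA
  by_cases h : R.Nonempty
  · beta_reduce
    rw [dif_pos h]
    have hi := h.choose_spec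
    set i := h.choose
    have hRi : R = {i} := Finset.eq_singleton_iff_unique_mem.2
      ⟨hi, fun j hj => Finset.card_le_one.1 hR _ hj _ hi⟩
    refine (Spec.findNonzero (v := A i) (List.finRange D) fun j _ => hA i hi j).step ?_
    rintro (_ | j) t hst ⟨rfl, h1, h2⟩
    · refine Spec.done (by simp) ⟨0, IsPivot.of_row_eq_zero ?_, by simp⟩
      intro i' hi'
      rw [hRi, Finset.mem_singleton] at hi'
      subst hi'
      exact funext fun j => h1 rfl j (List.mem_finRange j)
    · have hj : A i j ≠ 0 := h2 j rfl
      refine (Spec.const 1).step fun e t₁ hs₁ he => ?_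
      refine (Spec.arith (r := 1 / A i j) he ((hA i hi j).mono hs₁)
        (by simp [ArithOp.eval, hj])).step fun w t₂ hs₂ hw => Spec.done (by simp) ?_
      rw [hRi]
      refine ⟨_, IsPivot.of_entry_ne_zero hj, ?_⟩
      intro q hq p hp
      rw [Finset.mem_singleton.1 hq, Finset.mem_singleton.1 hp]
      simpa using hw
  · beta_reduce
    rw [dif_neg h]
    rw [Finset.not_nonempty_iff_eq_empty] at h
    subst h
    exact Spec.done (by positivity) ⟨0, IsPivot.of_row_eq_zero (by simp), by simp⟩

/-- The row indices `a, a + 1, …, a + l - 1`, as far as they exist. -/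
def rowsFrom (N a l : ℕ) : Finset (Fin N) := Finset.univ.filter fun i => a ≤ i ∧ (i : ℕ) < a + l

theorem card_rowsFrom_le (N a l : ℕ) : (rowsFrom N a l).card ≤ l := by
  have h : ((rowsFrom N a l).map Fin.valEmbedding) ⊆ Finset.Ico a (a + l) := by
    intro i hi
    simp only [rowsFrom, Finset.mem_map, Finset.mem_filter, Fin.valEmbedding_apply] at hi
    obtain ⟨i, ⟨_, hi⟩, rfl⟩ := hi
    exact Finset.mem_Ico.2 hi
  simpa using Finset.card_le_card h

theorem rowsFrom_union (N a l l' : ℕ) :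
    rowsFrom N a l ∪ rowsFrom N (a + l) l' = rowsFrom N a (l + l') := by
  ext i
  simp only [rowsFrom, Finset.mem_union, Finset.mem_filter, Finset.mem_univ, true_and]
  omega

theorem lt_of_mem_rowsFrom {N a l l' : ℕ} : ∀ i ∈ rowsFrom N a l, ∀ j ∈ rowsFrom N (a + l) l',
    i < j := by
  intro i hi j hj
  simp only [rowsFrom, Finset.mem_filter, Finset.mem_univ, true_and] at hi hj
  exact Fin.lt_def.2 (by omega)

/-- The constant in the cost of finding pivots in a square matrix. It solves
`2 * C + mergeConst c ≤ C * 2 ^ (ω - 1)`, the recursion for halving the set of rows. -/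
noncomputable def pivotConst (ω c : ℝ) : ℝ := mergeConst c / (2 ^ (ω - 1) - 2) + 2

theorem two_lt_two_rpow {ω : ℝ} (hω : 2 < ω) : (2 : ℝ) < 2 ^ (ω - 1) := by
  calc (2 : ℝ) = 2 ^ (1 : ℝ) := by simp
    _ < _ := Real.rpow_lt_rpow_of_exponent_lt (by norm_num) (by linarith)

theorem mergeConst_pos (c : ℝ) : 0 < mergeConst c := by
  unfold mergeConst; positivity

theorem two_le_pivotConst {ω : ℝ} (hω : 2 < ω) (c : ℝ) : 2 ≤ pivotConst ω c := by
  have := div_pos (mergeConst_pos c) (sub_pos.2 (two_lt_two_rpow hω))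
  unfold pivotConst
  linarith

theorem two_mul_pivotConst_add {ω : ℝ} (hω : 2 < ω) (c : ℝ) :
    2 * pivotConst ω c + mergeConst c ≤ pivotConst ω c * 2 ^ (ω - 1) := by
  have h := two_lt_two_rpow hω
  have h' : mergeConst c / (2 ^ (ω - 1) - 2) * (2 ^ (ω - 1) - 2) = mergeConst c :=
    div_mul_cancel₀ _ (by linarith)
  unfold pivotConst
  nlinarith

theorem two_pow_rpow (ω : ℝ) (j : ℕ) : ((2 ^ j : ℕ) : ℝ) ^ ω = 2 ^ j * (2 ^ (ω - 1)) ^ j := by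
  rw [← mul_pow]
  have h : (2 : ℝ) * 2 ^ (ω - 1) = 2 ^ ω := by
    rw [Real.rpow_sub_one (by norm_num)]
    ring
  rw [h, ← Real.rpow_natCast, ← Real.rpow_mul (by norm_num), mul_comm, Real.rpow_mul (by norm_num)]
  simp

/-- Divide and conquer: `2 ^ j` rows are treated by halves. -/
theorem exists_pivots_two_pow {ω c : ℝ} (hω : 2 < ω) (h : MatMulIn K ω c) (N D k : ℕ)
    (hD : D ≤ 2 ^ k) (j : ℕ) (hj : j ≤ k) :
    ∃ p : ℕ → (Fin N → Fin D → ι ⊕ ℕ) → Prog K ι Q (PivotOut ι N D),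
      ∀ a, FindsPivots (p a) (rowsFrom N a (2 ^ j))
        (pivotConst ω c * 2 ^ k * (2 ^ (ω - 1)) ^ j) := by
  induction j with
  | zero =>
    obtain ⟨p, hp⟩ := exists_pivots_card_le_one (K := K) (ι := ι) (Q := Q) N D
    refine ⟨fun a => p (rowsFrom N a (2 ^ 0)), fun a =>
      (hp _ (by simpa using card_rowsFrom_le N a 1)).mono ?_⟩
    have h1 := two_le_pivotConst hω c
    have h2 : (D : ℝ) ≤ 2 ^ k := by exact_mod_cast hD
    have h3 : (1 : ℝ) ≤ 2 ^ k := one_le_pow₀ (by norm_num)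
    simp only [pow_zero, mul_one]
    nlinarith
  | succ j ih =>
    obtain ⟨p, hp⟩ := ih (by omega)
    have hkj : 2 ^ (k - j) * 2 ^ j = 2 ^ k := by rw [← pow_add]; congr 1; omega
    obtain ⟨mg, hmg⟩ := exists_merge (ι := ι) (Q := Q) hω h N D (2 ^ j) (2 ^ (k - j))
      Nat.one_le_two_pow (hkj ▸ hD)
    refine ⟨fun a loc => p a loc >>= fun o => mg loc o (rowsFrom N (a + 2 ^ j) (2 ^ j))
      (p (a + 2 ^ j)), ?_⟩
    intro a E s loc A hA
    have hsplit : rowsFrom N a (2 ^ (j + 1)) =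
        rowsFrom N a (2 ^ j) ∪ rowsFrom N (a + 2 ^ j) (2 ^ j) := by
      rw [rowsFrom_union, pow_succ, mul_two]
    rw [hsplit] at hA ⊢
    refine ((hp a E s loc A fun i hi => hA i (Finset.mem_union_left _ hi)).bind
      fun o t hst ho => hmg E t loc A o _ _ (p (a + 2 ^ j)) _ (fun i hi j => (hA i hi j).mono hst)
        ho lt_of_mem_rowsFrom ?_ (card_rowsFrom_le _ _ _) (hp _)).mono ?_ fun _ _ _ h => h
    · obtain ⟨W, hW, _⟩ := ho
      exact hW.card_le.trans (card_rowsFrom_le _ _ _)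
    · have hkj' : ((2 ^ (k - j) : ℕ) : ℝ) * 2 ^ j = 2 ^ k := by exact_mod_cast hkj
      have h1 := two_mul_pivotConst_add hω c
      rw [two_pow_rpow, pow_succ]
      have h2 : (0 : ℝ) ≤ 2 ^ k * (2 ^ (ω - 1)) ^ j := by positivity
      calc _ = (2 * pivotConst ω c) * (2 ^ k * (2 ^ (ω - 1)) ^ j) +
            mergeConst c * ((((2 ^ (k - j) : ℕ) : ℝ) * 2 ^ j) * (2 ^ (ω - 1)) ^ j) := by ring
        _ = (2 * pivotConst ω c + mergeConst c) * (2 ^ k * (2 ^ (ω - 1)) ^ j) := by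
          rw [hkj']; ring
        _ ≤ (pivotConst ω c * 2 ^ (ω - 1)) * (2 ^ k * (2 ^ (ω - 1)) ^ j) :=
          mul_le_mul_of_nonneg_right h1 h2
        _ = _ := by ring

/-- Tall matrices: the rows are treated in blocks of `2 ^ k`. -/
theorem exists_pivots {ω c : ℝ} (hω : 2 < ω) (h : MatMulIn K ω c) (N D k : ℕ)
    (hD : D ≤ 2 ^ k) (q : ℕ) (hN : N ≤ q * 2 ^ k) :
    ∃ p : (Fin N → Fin D → ι ⊕ ℕ) → Prog K ι Q (PivotOut ι N D),
      FindsPivots p Finset.univ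
        (q * ((pivotConst ω c + mergeConst c) * ((2 ^ k : ℕ) : ℝ) ^ ω)) := by
  obtain ⟨p, hp⟩ := exists_pivots_two_pow (ι := ι) (Q := Q) hω h N D k hD k le_rfl
  obtain ⟨mg, hmg⟩ := exists_merge (ι := ι) (Q := Q) hω h N D (2 ^ k) 1 le_rfl (by simpa using hD)
  have key : ∀ q : ℕ, ∃ p : (Fin N → Fin D → ι ⊕ ℕ) → Prog K ι Q (PivotOut ι N D),
      FindsPivots p (rowsFrom N 0 (q * 2 ^ k))
        (q * ((pivotConst ω c + mergeConst c) * ((2 ^ k : ℕ) : ℝ) ^ ω)) := by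
    intro q
    induction q with
    | zero =>
      refine ⟨fun _ => pure (∅, ∅, fun _ _ => .inr 0), fun E s a A _ => ?_⟩
      exact Spec.done (by simp) ⟨0, IsPivot.of_row_eq_zero (by simp [rowsFrom]), by simp⟩
    | succ q ih =>
      obtain ⟨p', hp'⟩ := ih
      refine ⟨fun loc => p' loc >>= fun o => mg loc o (rowsFrom N (0 + q * 2 ^ k) (2 ^ k))
        (p (0 + q * 2 ^ k)), ?_⟩
      intro E s loc A hA
      have hsplit : rowsFrom N 0 ((q + 1) * 2 ^ k) =
          rowsFrom N 0 (q * 2 ^ k) ∪ rowsFrom N (0 + q * 2 ^ k) (2 ^ k) := by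
        rw [rowsFrom_union, add_mul, one_mul]
      rw [hsplit] at hA ⊢
      refine ((hp' E s loc A fun i hi => hA i (Finset.mem_union_left _ hi)).bind
        fun o t hst ho => hmg E t loc A o _ _ (p (0 + q * 2 ^ k)) _
          (fun i hi j => (hA i hi j).mono hst)
          ho lt_of_mem_rowsFrom ?_ (card_rowsFrom_le _ _ _) (hp _)).mono ?_ fun _ _ _ h => h
      · exact (Finset.card_le_univ _).trans (by simpa using hD)
      · rw [two_pow_rpow]
        push_cast
        linarith
  obtain ⟨p', hp'⟩ := key q
  refine ⟨p', ?_⟩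
  have : rowsFrom N 0 (q * 2 ^ k) = Finset.univ := by
    ext i
    simp only [rowsFrom, Finset.mem_filter, Finset.mem_univ, true_and]
    exact iff_of_true ⟨Nat.zero_le _, by rw [zero_add]; exact i.2.trans_le hN⟩ trivial
  rwa [this] at hp'

end PivotRecursion

/-! ### Monomial orders and standard monomials -/

section Monomials

variable {r m : ℕ}

theorem Mon.mulBy_zero (μ : Mon r m) : μ.mulBy 0 = μ := by
  simp [Mon.mulBy]

theorem Mon.exists_mulBy {μ ν : Mon r m} (h : μ.Divides ν) : ∃ κ, ν = μ.mulBy κ :=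
  ⟨ν.2 - μ.2, Prod.ext h.1.symm (tsub_add_cancel_of_le h.2).symm⟩

theorem Mon.divides_mulBy (κ : Fin r →₀ ℕ) (μ : Mon r m) : μ.Divides (μ.mulBy κ) :=
  ⟨rfl, le_add_self⟩

theorem Mon.Divides.antisymm {μ ν : Mon r m} (h : μ.Divides ν) (h' : ν.Divides μ) : μ = ν :=
  Prod.ext h.1 (le_antisymm h.2 h'.2)

namespace ModuleMonomialOrder

variable (ord : ModuleMonomialOrder r m)

theorem mulBy_lt_mulBy {μ ν : Mon r m} (κ : Fin r →₀ ℕ) (h : ord.lt μ ν) :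
    ord.lt (μ.mulBy κ) (ν.mulBy κ) := by
  by_cases hκ : κ = 0
  · subst hκ
    simpa [Mon.mulBy_zero] using h
  · exact (ord.lt_mulBy μ ν κ hκ h).2

theorem asymm {μ ν : Mon r m} (h : ord.lt μ ν) : ¬ ord.lt ν μ := fun h' =>
  ord.irrefl _ (ord.trans _ _ _ h h')

theorem lt_mulBy_self {κ : Fin r →₀ ℕ} (hκ : κ ≠ 0) (μ : Mon r m) : ord.lt μ (μ.mulBy κ) := by
  rcases ord.total μ (μ.mulBy κ) with h | h | h
  · exact h
  · exfalso
    have h' : κ + μ.2 = μ.2 := (congrArg Prod.snd h).symm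
    exact hκ (by simpa using h')
  · obtain ⟨h1, h2⟩ := ord.lt_mulBy _ _ κ hκ h
    exact absurd h2 (ord.asymm h1)

/-- Monomial orders are well-orders, by Dickson's lemma. -/
theorem wellFounded : WellFounded ord.lt := by
  have : IsStrictOrder (Mon r m) ord.lt := { irrefl := ord.irrefl, trans := ord.trans }
  rw [RelEmbedding.wellFounded_iff_isEmpty]
  refine ⟨fun f => ?_⟩
  have hwqo : WellQuasiOrdered fun μ ν : Mon r m => μ.1 = ν.1 ∧ μ.2 ≤ ν.2 :=
    WellQuasiOrdered.prod (r := (· = ·)) (Finite.wellQuasiOrdered _)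
      (wellQuasiOrdered_le (α := Fin r →₀ ℕ))
  obtain ⟨i, j, hij, h⟩ := hwqo fun n => f n
  obtain ⟨κ, hκ⟩ := Mon.exists_mulBy (μ := f i) (ν := f j) h
  have hlt : ord.lt (f j) (f i) := f.map_rel_iff.2 hij
  by_cases h0 : κ = 0
  · rw [hκ, h0, Mon.mulBy_zero] at hlt
    exact ord.irrefl _ hlt
  · rw [hκ] at hlt
    exact ord.asymm hlt (ord.lt_mulBy_self h0 _)

/-- A finite set of monomials can be listed in increasing order. -/
theorem exists_enumeration (C : Finset (Mon r m)) :
    ∃ σ : Fin C.card → Mon r m, (∀ i j, i < j → ord.lt (σ i) (σ j)) ∧ Set.range σ = C := by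
  classical
  have : IsStrictTotalOrder (Mon r m) ord.lt :=
    { irrefl := ord.irrefl, trans := ord.trans
      trichotomous := fun μ ν h1 h2 => (ord.total μ ν).elim (absurd · h1) fun h =>
        h.elim id (absurd · h2) }
  let lin : LinearOrder (Mon r m) := linearOrderOfSTO ord.lt
  refine ⟨@Finset.orderEmbOfFin _ lin C _ rfl, fun i j hij => ?_,
    @Finset.range_orderEmbOfFin _ lin C _ rfl⟩
  exact (@OrderEmbedding.lt_iff_lt _ _ _ lin.toPreorder
    (@Finset.orderEmbOfFin _ lin C _ rfl) i j).2 hij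

theorem exists_greatest {C : Finset (Mon r m)} (hC : C.Nonempty) :
    ∃ ν ∈ C, ∀ μ ∈ C, μ ≠ ν → ord.lt μ ν := by
  classical
  induction hC using Finset.Nonempty.cons_induction with
  | singleton a => exact ⟨a, by simp, by simp⟩
  | cons a s ha hs ih =>
    obtain ⟨ν, hν, h⟩ := ih
    rcases ord.total a ν with h' | h' | h'
    · refine ⟨ν, by simp [hν], fun μ hμ hne => ?_⟩
      rcases Finset.mem_cons.1 hμ with rfl | hμ
      · exact h'
      · exact h μ hμ hne
    · exact absurd (h' ▸ hν) ha
    · refine ⟨a, by simp, fun μ hμ hne => ?_⟩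
      have hμ := (Finset.mem_cons.1 hμ).resolve_left hne
      by_cases hμν : μ = ν
      · rwa [hμν]
      · exact ord.trans _ _ _ (h μ hμ hμν) h'

end ModuleMonomialOrder

section Standard

variable {K V : Type*} [Field K] [AddCommGroup V] [Module K V] (ord : ModuleMonomialOrder r m)
  (φ : Mon r m → V)

/-- The standard monomials of a set `T` of monomials with respect to a family `φ` of vectors:
those `ν ∈ T` for which `φ ν` is not a combination of the vectors of smaller monomials in `T`. -/
def standardMons (K : Type*) {V : Type*} [Field K] [AddCommGroup V] [Module K V]
    (ord : ModuleMonomialOrder r m) (φ : Mon r m → V) (T : Set (Mon r m)) : Set (Mon r m) :=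
  {ν | ν ∈ T ∧ φ ν ∉ Submodule.span K (φ '' {μ | μ ∈ T ∧ ord.lt μ ν})}

variable {ord φ} {T T' C : Set (Mon r m)}

theorem standardMons_subset : standardMons K ord φ T ⊆ T := fun _ h => h.1

theorem mem_span_standardMons {ν : Mon r m} : ν ∈ T →
    φ ν ∈ Submodule.span K (φ '' {μ | μ ∈ standardMons K ord φ T ∧ (μ = ν ∨ ord.lt μ ν)}) := by
  induction ν using ord.wellFounded.induction with
  | _ ν ih =>
    intro hν
    by_cases h : ν ∈ standardMons K ord φ T
    · exact Submodule.subset_span ⟨ν, ⟨h, Or.inl rfl⟩, rfl⟩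
    · have h' : φ ν ∈ Submodule.span K (φ '' {μ | μ ∈ T ∧ ord.lt μ ν}) := by
        by_contra h'
        exact h ⟨hν, h'⟩
      refine Submodule.span_le.2 ?_ h'
      rintro _ ⟨μ, ⟨hμ, hlt⟩, rfl⟩
      refine Submodule.span_mono (Set.image_mono ?_) (ih μ hlt hμ)
      rintro ξ ⟨hξ, hξμ⟩
      refine ⟨hξ, Or.inr ?_⟩
      rcases hξμ with rfl | hξμ
      · exact hlt
      · exact ord.trans _ _ _ hξμ hlt

theorem span_lt_le_span_standardMons (ν : Mon r m) :
    Submodule.span K (φ '' {μ | μ ∈ T ∧ ord.lt μ ν}) ≤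
      Submodule.span K (φ '' {μ | μ ∈ standardMons K ord φ T ∧ ord.lt μ ν}) := by
  rw [Submodule.span_le]
  rintro _ ⟨μ, ⟨hμ, hlt⟩, rfl⟩
  refine Submodule.span_mono (Set.image_mono ?_) (mem_span_standardMons (ord := ord) hμ)
  rintro ξ ⟨hξ, hξμ⟩
  refine ⟨hξ, ?_⟩
  rcases hξμ with rfl | hξμ
  · exact hlt
  · exact ord.trans _ _ _ hξμ hlt

/-- Standard monomials may be computed from any set of candidates which contains them. -/
theorem standardMons_eq_of_subset (h : standardMons K ord φ T ⊆ C) (hC : C ⊆ T) :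
    standardMons K ord φ C = standardMons K ord φ T := by
  refine Set.Subset.antisymm (fun ν hν => ⟨hC hν.1, fun h' => hν.2 ?_⟩)
    fun ν hν => ⟨h hν, fun h' => hν.2 ?_⟩
  · refine Submodule.span_mono (Set.image_mono ?_) (span_lt_le_span_standardMons ν h')
    exact fun μ hμ => ⟨h hμ.1, hμ.2⟩
  · refine Submodule.span_mono (Set.image_mono ?_) h'
    exact fun μ hμ => ⟨hC hμ.1, hμ.2⟩

theorem standardMons_idem :
    standardMons K ord φ (standardMons K ord φ T) = standardMons K ord φ T :=
  standardMons_eq_of_subset subset_rfl standardMons_subset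

theorem linearIndepOn_standardMons : LinearIndepOn K φ (standardMons K ord φ T) := by
  classical
  rw [linearIndepOn_iff]
  intro l hl h0
  by_contra hne
  obtain ⟨ν, hν, hmax⟩ := ord.exists_greatest (Finsupp.support_nonempty_iff.2 hne)
  have hmem : ∀ μ ∈ l.support, μ ∈ standardMons K ord φ T := fun μ hμ => hl hμ
  refine (hmem ν hν).2 ?_
  rw [Finsupp.linearCombination_apply, Finsupp.sum, ← Finset.add_sum_erase _ _ hν] at h0
  have hν0 : l ν ≠ 0 := Finsupp.mem_support_iff.1 hν
  have : φ ν = (l ν)⁻¹ • -∑ μ ∈ l.support.erase ν, l μ • φ μ := by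
    rw [← eq_neg_iff_add_eq_zero.2 h0, smul_smul, inv_mul_cancel₀ hν0, one_smul]
  rw [this]
  refine Submodule.smul_mem _ _ (Submodule.neg_mem _ (Submodule.sum_mem _ fun μ hμ =>
    Submodule.smul_mem _ _ (Submodule.subset_span ⟨μ, ⟨?_, ?_⟩, rfl⟩)))
  · exact (hmem μ (Finset.mem_of_mem_erase hμ)).1
  · exact hmax μ (Finset.mem_of_mem_erase hμ) (Finset.ne_of_mem_erase hμ)

theorem card_le_finrank_of_subset_standardMons [FiniteDimensional K V] {S : Finset (Mon r m)}
    (h : (S : Set (Mon r m)) ⊆ standardMons K ord φ T) : S.card ≤ Module.finrank K V := by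
  have := (linearIndepOn_standardMons.mono h : LinearIndepOn K φ (S : Set (Mon r m)))
  have h2 := LinearIndependent.fintype_card_le_finrank this
  simpa using h2

/-- Multiplication of monomials is compatible with linear maps between their vectors. -/
def IsEquivariant (K : Type*) {V : Type*} [Field K] [AddCommGroup V] [Module K V]
    (φ : Mon r m → V) : Prop :=
  ∀ κ : Fin r →₀ ℕ, ∃ L : V →ₗ[K] V, ∀ μ, φ (μ.mulBy κ) = L (φ μ)

/-- Divisors of standard monomials are standard. -/
theorem IsEquivariant.mem_standardMons (hφ : IsEquivariant K φ) {κ : Fin r →₀ ℕ} {ν : Mon r m}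
    (h : ν.mulBy κ ∈ standardMons K ord φ T') (hν : ν ∈ T)
    (hT : ∀ μ ∈ T, μ.mulBy κ ∈ T') : ν ∈ standardMons K ord φ T := by
  refine ⟨hν, fun h' => h.2 ?_⟩
  obtain ⟨L, hL⟩ := hφ κ
  rw [hL]
  have := Submodule.mem_map_of_mem (f := L) h'
  rw [Submodule.map_span, ← Set.image_comp] at this
  refine Submodule.span_mono ?_ this
  rintro _ ⟨μ, ⟨hμ, hlt⟩, rfl⟩
  exact ⟨μ.mulBy κ, ⟨hT μ hμ, ord.mulBy_lt_mulBy κ hlt⟩, hL μ⟩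

/-! ### Standard monomials in the first variables -/

/-- The monomials in which only the variables with index less than `k` occur. -/
def firstVars (r m k : ℕ) : Set (Mon r m) := {μ | ∀ j : Fin r, k ≤ j → μ.2 j = 0}

/-- The monomials in the first variables up to the `k`-th, of degree less than `b` in the latter. -/
def degLT (m : ℕ) (k : Fin r) (b : ℕ) : Set (Mon r m) :=
  {μ | μ ∈ firstVars r m (k + 1) ∧ μ.2 k < b}

theorem degLT_one (k : Fin r) : degLT m k 1 = firstVars r m k := by
  ext μ
  simp only [degLT, firstVars, Set.mem_ofPred_eq, Nat.lt_one_iff]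
  constructor
  · rintro ⟨h1, h2⟩ j hj
    rcases Nat.eq_or_lt_of_le hj with h | h
    · rw [← Fin.ext h, h2]
    · exact h1 j h
  · intro h
    exact ⟨fun j hj => h j (by omega), h k le_rfl⟩

theorem degLT_subset (k : Fin r) (b : ℕ) : degLT m k b ⊆ firstVars r m (k + 1) := fun _ h => h.1

theorem firstVars_all : firstVars r m r = Set.univ :=
  Set.eq_univ_of_forall fun _ j hj => absurd j.2 (by omega)

theorem mulBy_single_mem_firstVars {k : Fin r} {μ : Mon r m} (b : ℕ)
    (h : μ ∈ firstVars r m (k + 1)) : μ.mulBy (Finsupp.single k b) ∈ firstVars r m (k + 1) := by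
  intro j hj
  have hjk : k ≠ j := by rintro rfl; omega
  simp [Mon.mulBy, hjk, h j hj]

theorem exists_mulBy_single {k : Fin r} {ν : Mon r m} {b : ℕ} (hb : b ≤ ν.2 k) :
    ∃ ν' : Mon r m, ν = ν'.mulBy (Finsupp.single k b) ∧ ν'.2 k + b = ν.2 k ∧
      ∀ n, ν ∈ firstVars r m n → ν' ∈ firstVars r m n := by
  refine ⟨(ν.1, ν.2 - Finsupp.single k b), Prod.ext rfl ?_, ?_, ?_⟩
  · exact (add_tsub_cancel_of_le (Finsupp.single_le_iff.2 hb)).symm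
  · simp [hb]
  · intro n hn j hj
    simp [hn j hj]

/-- The standard monomials of degree less than `2 * b` in the `k`-th variable are found among those
of degree less than `b` and their multiples by the `b`-th power of the variable. -/
theorem IsEquivariant.standardMons_degLT_subset (hφ : IsEquivariant K φ) (k : Fin r) (b : ℕ) :
    standardMons K ord φ (degLT m k (2 * b)) ⊆ standardMons K ord φ (degLT m k b) ∪
      (fun μ => μ.mulBy (Finsupp.single k b)) '' standardMons K ord φ (degLT m k b) := by
  intro ν hν
  have h1 := standardMons_subset hν
  rcases lt_or_ge (ν.2 k) b with h | h
  · left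
    rw [← Mon.mulBy_zero ν] at hν
    refine hφ.mem_standardMons hν ⟨h1.1, h⟩ fun μ hμ => ?_
    rw [Mon.mulBy_zero]
    exact ⟨hμ.1, by have := hμ.2; omega⟩
  · right
    obtain ⟨ν', rfl, h2, h3⟩ := exists_mulBy_single h
    refine ⟨ν', hφ.mem_standardMons hν ⟨h3 _ h1.1, ?_⟩ fun μ hμ =>
      ⟨mulBy_single_mem_firstVars b hμ.1, ?_⟩, rfl⟩
    · have := h1.2
      omega
    · have := hμ.2
      simp only [Mon.mulBy, Finsupp.add_apply, Finsupp.single_eq_same]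
      omega

/-- If doubling the degree bound gives no further standard monomials, then no degree does. -/
theorem IsEquivariant.standardMons_of_stable (hφ : IsEquivariant K φ) {k : Fin r} {b : ℕ}
    (hb : 1 ≤ b)
    (h : standardMons K ord φ (degLT m k (2 * b)) = standardMons K ord φ (degLT m k b)) :
    standardMons K ord φ (firstVars r m (k + 1)) = standardMons K ord φ (degLT m k b) := by
  refine (standardMons_eq_of_subset ?_ (degLT_subset k b)).symm
  intro ν hν
  refine ⟨hν.1, ?_⟩
  by_contra hlt
  obtain ⟨ν', hν', h2, h3⟩ := exists_mulBy_single (Nat.sub_le (ν.2 k) b)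
  rw [hν'] at hν
  have h4 := hφ.mem_standardMons (T := degLT m k (2 * b)) hν
    ⟨h3 _ (hν' ▸ hν.1), by omega⟩ fun μ hμ => mulBy_single_mem_firstVars _ hμ.1
  rw [h] at h4
  have := h4.1.2
  omega

end Standard

end Monomials

/-! ### The vectors of monomials, and the syzygy module -/

section Rows

variable {K : Type u} [Field K] {r m D : ℕ}

/-- The vector `μ · F` for a monomial `μ`. -/
def monRow (M : Fin r → Matrix (Fin D) (Fin D) K) (F : Matrix (Fin m) (Fin D) K) (μ : Mon r m) :
    Fin D → K :=
  Matrix.vecMul (F μ.1) (matPow M μ.2)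

variable {M : Fin r → Matrix (Fin D) (Fin D) K} {F : Matrix (Fin m) (Fin D) K}

theorem matPow_zero (M : Fin r → Matrix (Fin D) (Fin D) K) : matPow M 0 = 1 := by
  simp [matPow]

theorem prod_ofFn_eq_of_ne {A : Type*} [Monoid A] :
    ∀ {r : ℕ} (f : Fin r → A) (k : Fin r), (∀ j, j ≠ k → f j = 1) → (List.ofFn f).prod = f k
  | 0, _, k, _ => k.elim0
  | r + 1, f, k, h => by
    rw [List.ofFn_succ, List.prod_cons]
    induction k using Fin.cases with
    | zero =>
      have : (List.ofFn fun i : Fin r => f i.succ) = List.replicate r 1 := by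
        rw [← List.ofFn_const]
        congr 1
        exact funext fun i => h _ (Fin.succ_ne_zero i)
      rw [this, List.prod_replicate, one_pow, mul_one]
    | succ k =>
      rw [h 0 (Fin.succ_ne_zero k).symm, one_mul]
      exact prod_ofFn_eq_of_ne (fun i : Fin r => f i.succ) k fun j hj =>
        h _ fun h' => hj (Fin.succ_injective _ h')

theorem matPow_single (M : Fin r → Matrix (Fin D) (Fin D) K) (k : Fin r) (b : ℕ) :
    matPow M (Finsupp.single k b) = M k ^ b := by
  unfold matPow
  rw [prod_ofFn_eq_of_ne _ k fun j hj => by rw [Finsupp.single_eq_of_ne hj, pow_zero],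
    Finsupp.single_eq_same]

theorem monRow_mulBy (hM : ∀ i j, Commute (M i) (M j)) (κ : Fin r →₀ ℕ) (μ : Mon r m) :
    monRow M F (μ.mulBy κ) = Matrix.vecMul (monRow M F μ) (matPow M κ) := by
  simp only [monRow, Mon.mulBy, Matrix.vecMul_vecMul]
  rw [add_comm, matPow_add hM]

theorem monRow_mulBy_single (hM : ∀ i j, Commute (M i) (M j)) (k : Fin r) (b : ℕ) (μ : Mon r m) :
    monRow M F (μ.mulBy (Finsupp.single k b)) = Matrix.vecMul (monRow M F μ) (M k ^ b) := by
  rw [monRow_mulBy hM, matPow_single]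

theorem isEquivariant_monRow (hM : ∀ i j, Commute (M i) (M j)) : IsEquivariant K (monRow M F) :=
  fun κ => ⟨(matPow M κ).vecMulLinear, fun μ => monRow_mulBy hM κ μ⟩

/-- The degree of a standard monomial in a variable is less than the degree of the minimal
polynomial of the corresponding matrix. -/
theorem standardMons_firstVars_subset (hM : ∀ i j, Commute (M i) (M j))
    (ord : ModuleMonomialOrder r m) (k : Fin r) {b : ℕ} (hb : (minpoly K (M k)).natDegree ≤ b) :
    standardMons K ord (monRow M F) (firstVars r m (k + 1)) ⊆ degLT m k b := by
  intro ν hν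
  refine ⟨hν.1, ?_⟩
  by_contra hlt
  set d := (minpoly K (M k)).natDegree with hd
  obtain ⟨ν', rfl, -, h3⟩ := exists_mulBy_single (k := k) (ν := ν) (b := d) (by omega)
  have h3' := h3 _ hν.1
  refine hν.2 ?_
  have hmonic := minpoly.monic (Matrix.isIntegral (R := K) (M k))
  have hpow : M k ^ d = -∑ i ∈ Finset.range d, (minpoly K (M k)).coeff i • M k ^ i := by
    have h0 := minpoly.aeval K (M k)
    rw [Polynomial.aeval_eq_sum_range, Finset.sum_range_succ, ← hd,
      show (minpoly K (M k)).coeff d = 1 from hmonic.coeff_natDegree, one_smul] at h0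
    exact eq_neg_of_add_eq_zero_right h0
  rw [monRow_mulBy_single hM, hpow, Matrix.vecMul_neg, Matrix.vecMul_sum]
  refine Submodule.neg_mem _ (Submodule.sum_mem _ fun i hi => ?_)
  rw [Matrix.vecMul_smul, ← monRow_mulBy_single hM]
  refine Submodule.smul_mem _ _ (Submodule.subset_span ⟨_, ⟨?_, ?_⟩, rfl⟩)
  · exact mulBy_single_mem_firstVars i h3'
  · have hid : i < d := Finset.mem_range.1 hi
    have : ν'.mulBy (Finsupp.single k d) =
        (ν'.mulBy (Finsupp.single k i)).mulBy (Finsupp.single k (d - i)) := by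
      refine Prod.ext rfl ?_
      simp only [Mon.mulBy]
      rw [← add_assoc, ← Finsupp.single_add, Nat.sub_add_cancel hid.le]
    rw [this]
    exact ord.lt_mulBy_self (Finsupp.single_ne_zero.2 (Nat.sub_pos_of_lt hid).ne') _

theorem standardMons_firstVars_eq (hM : ∀ i j, Commute (M i) (M j))
    (ord : ModuleMonomialOrder r m) (k : Fin r) {b : ℕ} (hb : (minpoly K (M k)).natDegree ≤ b) :
    standardMons K ord (monRow M F) (firstVars r m (k + 1)) =
      standardMons K ord (monRow M F) (degLT m k b) :=
  (standardMons_eq_of_subset (standardMons_firstVars_subset hM ord k hb) (degLT_subset k b)).symm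

/-- The pivot rows of a matrix whose rows are the vectors of an increasing sequence of monomials
are those of the standard monomials. -/
theorem IsPivot.image_eq_standardMons {N : ℕ} {ord : ModuleMonomialOrder r m}
    {φ : Mon r m → Fin D → K} {σ : Fin N → Mon r m} (hσ : ∀ i j, i < j → ord.lt (σ i) (σ j))
    {A : Matrix (Fin N) (Fin D) K} (hA : ∀ i, A i = φ (σ i)) {P : Finset (Fin N)}
    {Q : Finset (Fin D)} {W : Matrix (Fin D) (Fin N) K} (h : IsPivot A Finset.univ P Q W) :
    σ '' P = standardMons K ord φ (Set.range σ) := by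
  have hlt : ∀ i j, ord.lt (σ i) (σ j) → i < j := fun i j hij => by
    rcases lt_trichotomy i j with h | h | h
    · exact h
    · exact absurd hij (h ▸ ord.irrefl _)
    · exact absurd hij (ord.asymm (hσ j i h))
  refine Set.Subset.antisymm ?_ ?_
  · rintro _ ⟨p, hp, rfl⟩
    refine ⟨⟨p, rfl⟩, fun hspan => ?_⟩
    -- the `p`-th coordinate after multiplication by `W` kills all earlier rows, but not row `p`
    let f : (Fin D → K) →ₗ[K] K := (LinearMap.proj p).comp W.vecMulLinear
    have hf : ∀ i, f (φ (σ i)) = (A * W) i p := fun i => by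
      rw [Matrix.mul_apply_eq_vecMul, hA]
      rfl
    have hker : Submodule.span K (φ '' {μ | μ ∈ Set.range σ ∧ ord.lt μ (σ p)}) ≤
        LinearMap.ker f := by
      rw [Submodule.span_le]
      rintro _ ⟨_, ⟨⟨i, rfl⟩, hi⟩, rfl⟩
      rw [SetLike.mem_coe, LinearMap.mem_ker, hf]
      exact h.triangular i (Finset.mem_univ _) p hp (hlt _ _ hi)
    have h1 := hker hspan
    rw [LinearMap.mem_ker, hf, h.inverse p hp p hp, Matrix.one_apply_eq] at h1
    exact one_ne_zero h1
  · rintro _ ⟨⟨i, rfl⟩, hi⟩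
    refine ⟨i, ?_, rfl⟩
    by_contra hiP
    refine hi ?_
    rw [← hA, ← h.reproduces i (Finset.mem_univ _), Matrix.mul_apply_eq_vecMul,
      Matrix.vecMul_eq_sum]
    refine Submodule.sum_mem _ fun p _ => ?_
    by_cases hp : p ∈ P
    · rcases lt_trichotomy p i with hpi | hpi | hpi
      · rw [hA]
        exact Submodule.smul_mem _ _ (Submodule.subset_span ⟨_, ⟨⟨p, rfl⟩, hσ _ _ hpi⟩, rfl⟩)
      · exact absurd (hpi ▸ hp) hiP
      · rw [h.triangular i (Finset.mem_univ _) p hp hpi, zero_smul]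
        exact Submodule.zero_mem _
    · rw [h.mul_apply_eq_zero _ _ hp, zero_smul]
      exact Submodule.zero_mem _

/-- When all rows are those of standard monomials, `W` gives the coefficients of the normal
forms of monomials that are not standard. -/
theorem IsPivot.normalForm {N : ℕ} {ord : ModuleMonomialOrder r m}
    {φ : Mon r m → Fin D → K} {σ : Fin N → Mon r m} (hσ : ∀ i j, i < j → ord.lt (σ i) (σ j))
    (hS : Set.range σ = standardMons K ord φ Set.univ)
    {A : Matrix (Fin N) (Fin D) K} (hA : ∀ i, A i = φ (σ i)) {P : Finset (Fin N)}
    {Q : Finset (Fin D)} {W : Matrix (Fin D) (Fin N) K} (h : IsPivot A Finset.univ P Q W)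
    {ν : Mon r m} (hν : ν ∉ standardMons K ord φ Set.univ) :
    φ ν = ∑ i, Matrix.vecMul (φ ν) W i • φ (σ i) ∧
      ∀ i, Matrix.vecMul (φ ν) W i ≠ 0 → ord.lt (σ i) ν := by
  have hinj : Function.Injective σ := fun i j hij => by
    by_contra hne
    rcases lt_or_gt_of_ne hne with h | h
    · exact ord.irrefl _ (hij ▸ hσ _ _ h)
    · exact ord.irrefl _ (hij ▸ hσ _ _ h)
  have hP : P = Finset.univ := by
    have h1 := h.image_eq_standardMons hσ hA
    rw [hS, standardMons_idem, ← hS, ← Set.image_univ] at h1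
    have h2 := hinj.image_injective h1
    exact Finset.coe_injective (by rw [h2, Finset.coe_univ])
  have hAW : A * W = 1 := by
    ext i j
    exact h.inverse i (hP ▸ Finset.mem_univ _) j (hP ▸ Finset.mem_univ _)
  have hspan : φ ν ∈ Submodule.span K
      (φ '' (σ '' {i | ord.lt (σ i) ν})) := by
    have h1 : φ ν ∈ Submodule.span K (φ '' {μ | μ ∈ Set.univ ∧ ord.lt μ ν}) := by
      by_contra h'
      exact hν ⟨Set.mem_univ _, h'⟩
    refine Submodule.span_mono (Set.image_mono ?_) (span_lt_le_span_standardMons ν h1)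
    rintro μ ⟨hμ, hlt⟩
    rw [← hS] at hμ
    obtain ⟨i, rfl⟩ := hμ
    exact ⟨i, hlt, rfl⟩
  rw [← Set.image_comp, Finsupp.mem_span_image_iff_linearCombination] at hspan
  obtain ⟨l, hl, hlν⟩ := hspan
  have hlA : Matrix.vecMul (l : Fin N → K) A = φ ν := by
    rw [← hlν, Finsupp.linearCombination_apply, Finsupp.sum_fintype _ _ (by simp),
      Matrix.vecMul_eq_sum]
    exact Finset.sum_congr rfl fun i _ => by rw [hA]; rfl
  have hcoef : Matrix.vecMul (φ ν) W = l := by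
    rw [← hlA, Matrix.vecMul_vecMul, hAW, Matrix.vecMul_one]
  rw [hcoef]
  refine ⟨?_, fun i hi => hl (Finsupp.mem_support_iff.2 hi)⟩
  rw [← hlA, Matrix.vecMul_eq_sum]
  exact Finset.sum_congr rfl fun i _ => by rw [hA]

end Rows

/-! ### The reduced Gröbner basis given by normal forms -/

section Groebner

variable {K : Type u} [Field K] {r m D : ℕ}

theorem coeffAt_add (f g : FreeMod K r m) (μ : Mon r m) :
    coeffAt (f + g) μ = coeffAt f μ + coeffAt g μ := by
  simp [coeffAt]

theorem coeffAt_sum {ι : Type*} (s : Finset ι) (f : ι → FreeMod K r m) (μ : Mon r m) :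
    coeffAt (∑ i ∈ s, f i) μ = ∑ i ∈ s, coeffAt (f i) μ := by
  simp [coeffAt, Finset.sum_apply, MvPolynomial.coeff_sum]

open Classical in
theorem coeffAt_term (μ ν : Mon r m) (a : K) :
    coeffAt (term μ a) ν = if μ = ν then a else 0 := by
  unfold coeffAt term
  by_cases h : μ.1 = ν.1
  · rw [h, Pi.single_eq_same, MvPolynomial.coeff_monomial]
    congr 1
    exact propext ⟨fun h' => Prod.ext h h', fun h' => congrArg Prod.snd h'⟩
  · rw [Pi.single_eq_of_ne (Ne.symm h), MvPolynomial.coeff_zero, if_neg]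
    rintro rfl
    exact h rfl

theorem ext_coeffAt {f g : FreeMod K r m} (h : ∀ μ, coeffAt f μ = coeffAt g μ) : f = g :=
  funext fun i => MvPolynomial.ext _ _ fun e => h (i, e)

theorem exists_coeffs (f : FreeMod K r m) : ∃ l : Mon r m →₀ K, ∀ μ, l μ = coeffAt f μ := by
  classical
  refine ⟨Finsupp.onFinset (Finset.univ.biUnion fun i => (f i).support.image (Prod.mk i))
    (coeffAt f) fun μ hμ => ?_, fun μ => rfl⟩
  simp only [Finset.mem_biUnion, Finset.mem_univ, true_and, Finset.mem_image]
  exact ⟨μ.1, μ.2, MvPolynomial.mem_support_iff.2 hμ, rfl⟩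

theorem eq_sum_term {f : FreeMod K r m} {l : Mon r m →₀ K} (h : ∀ μ, l μ = coeffAt f μ) :
    f = ∑ μ ∈ l.support, term μ (l μ) := by
  classical
  refine ext_coeffAt fun ν => ?_
  simp only [coeffAt_sum, coeffAt_term, Finset.sum_ite_eq', Finsupp.mem_support_iff, ← h]
  split_ifs with h'
  · rfl
  · simpa using h'

variable {M : Fin r → Matrix (Fin D) (Fin D) K} {F : Matrix (Fin m) (Fin D) K}

theorem act_term (μ : Mon r m) (a : K) : act M F (term μ a) = a • monRow M F μ := by
  unfold act term monRow
  rw [Finset.sum_eq_single μ.1]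
  · rw [Pi.single_eq_same, evalMat_monomial, Matrix.vecMul_smul]
  · intro i _ hi
    rw [Pi.single_eq_of_ne hi, evalMat_zero, Matrix.vecMul_zero]
  · simp

theorem act_zero : act M F 0 = 0 := by simp [act, evalMat_zero]

theorem act_sum {ι : Type*} (s : Finset ι) (f : ι → FreeMod K r m) :
    act M F (∑ i ∈ s, f i) = ∑ i ∈ s, act M F (f i) :=
  map_sum (⟨⟨act M F, act_zero⟩, act_add M F⟩ : FreeMod K r m →+ (Fin D → K)) f s

theorem monomial_smul_term (κ : Fin r →₀ ℕ) (ν : Mon r m) (a b : K) :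
    MvPolynomial.monomial κ a • (term ν b : FreeMod K r m) = term (ν.mulBy κ) (a * b) := by
  unfold term Mon.mulBy
  rw [← Pi.single_smul, smul_eq_mul, MvPolynomial.monomial_mul]

theorem IsLeadingMon.unique {ord : ModuleMonomialOrder r m} {f : FreeMod K r m} {μ ν : Mon r m}
    (hμ : IsLeadingMon ord f μ) (hν : IsLeadingMon ord f ν) : μ = ν := by
  by_contra h
  exact ord.asymm (hμ.2 ν hν.1 (Ne.symm h)) (hν.2 μ hμ.1 h)

/-- Leading monomials of syzygies are not standard. -/
theorem IsLeadingMon.notMem_standardMons {ord : ModuleMonomialOrder r m} {f : FreeMod K r m}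
    {μ : Mon r m} (hμ : IsLeadingMon ord f μ) (hf : act M F f = 0) :
    μ ∉ standardMons K ord (monRow M F) Set.univ := by
  classical
  intro h
  obtain ⟨l, hl⟩ := exists_coeffs f
  have hμ0 : l μ ≠ 0 := hl μ ▸ hμ.1
  rw [eq_sum_term hl, act_sum, ← Finset.add_sum_erase _ _ (Finsupp.mem_support_iff.2 hμ0),
    act_term] at hf
  refine h.2 ?_
  have : monRow M F μ = (l μ)⁻¹ • -∑ ν ∈ l.support.erase μ, act M F (term ν (l ν)) := by
    rw [← eq_neg_iff_add_eq_zero.2 hf, smul_smul, inv_mul_cancel₀ hμ0, one_smul]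
  rw [this]
  refine Submodule.smul_mem _ _ (Submodule.neg_mem _ (Submodule.sum_mem _ fun ν hν => ?_))
  rw [act_term]
  refine Submodule.smul_mem _ _ (Submodule.subset_span ⟨ν, ⟨Set.mem_univ _, hμ.2 ν ?_ ?_⟩, rfl⟩)
  · rw [← hl]
    exact Finsupp.mem_support_iff.1 (Finset.mem_of_mem_erase hν)
  · exact Finset.ne_of_mem_erase hν

/-- The monomials outside `S` all of whose proper divisors are in `S`. -/
def minimalOutside (S : Set (Mon r m)) : Set (Mon r m) :=
  {ν | ν ∉ S ∧ ∀ μ : Mon r m, μ.Divides ν → μ ≠ ν → μ ∈ S}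

theorem exists_minimalOutside_divides (ord : ModuleMonomialOrder r m) {S : Set (Mon r m)}
    {μ : Mon r m} : μ ∉ S → ∃ ν ∈ minimalOutside S, ν.Divides μ := by
  induction μ using ord.wellFounded.induction with
  | _ μ ih =>
    intro hμ
    by_cases h : ∀ ξ : Mon r m, ξ.Divides μ → ξ ≠ μ → ξ ∈ S
    · exact ⟨μ, ⟨hμ, h⟩, rfl, le_rfl⟩
    · push Not at h
      obtain ⟨ξ, hξ, hne, hξS⟩ := h
      obtain ⟨κ, rfl⟩ := Mon.exists_mulBy hξ
      have hκ : κ ≠ 0 := by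
        rintro rfl
        exact hne (Mon.mulBy_zero ξ).symm
      obtain ⟨ν, hν, hd⟩ := ih ξ (ord.lt_mulBy_self hκ ξ) hξS
      exact ⟨ν, hν, hd.1.trans hξ.1, hd.2.trans hξ.2⟩

/-- A minimal monomial outside `S` is a coordinate vector or a variable times an element of `S`. -/
theorem eq_zero_or_exists_of_minimalOutside {S : Set (Mon r m)} {ν : Mon r m}
    (h : ν ∈ minimalOutside S) :
    ν.2 = 0 ∨ ∃ k : Fin r, ∃ μ ∈ S, ν = μ.mulBy (Finsupp.single k 1) := by
  by_cases h0 : ν.2 = 0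
  · exact Or.inl h0
  · obtain ⟨k, hk⟩ := Finsupp.ne_iff.1 h0
    obtain ⟨μ, rfl, h2, -⟩ := exists_mulBy_single (k := k) (ν := ν) (b := 1)
      (Nat.one_le_iff_ne_zero.2 hk)
    refine Or.inr ⟨k, μ, h.2 μ (Mon.divides_mulBy _ _) ?_, rfl⟩
    intro h'
    rw [← h'] at h2
    omega

/-- The reduced Gröbner basis consists of the relations between minimal nonstandard monomials and
their normal forms. -/
theorem isReducedGroebnerBasis_of_normalForms (hM : ∀ i j, Commute (M i) (M j))
    {ord : ModuleMonomialOrder r m} {S L : Finset (Mon r m)}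
    (hS : (S : Set (Mon r m)) = standardMons K ord (monRow M F) Set.univ)
    (hL : (L : Set (Mon r m)) = minimalOutside S) {c : Mon r m → Mon r m → K}
    (hlt : ∀ ν ∈ L, ∀ μ ∈ S, c ν μ ≠ 0 → ord.lt μ ν)
    (hrel : ∀ ν ∈ L, monRow M F ν + ∑ μ ∈ S, c ν μ • monRow M F μ = 0) :
    IsReducedGroebnerBasis ord (syzygyModule M hM F)
      {f | ∃ ν ∈ L, f = term ν 1 + ∑ μ ∈ S, term μ (c ν μ)} := by
  classical
  have hL' : ∀ {ν}, ν ∈ L → ν ∈ minimalOutside (S : Set (Mon r m)) := fun hν => hL ▸ hν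
  have hνS : ∀ {ν}, ν ∈ L → ν ∉ S := fun hν => (hL' hν).1
  have hcoeff : ∀ ν ξ, coeffAt (term ν 1 + ∑ μ ∈ S, term μ (c ν μ)) ξ =
      (if ν = ξ then 1 else 0) + if ξ ∈ S then c ν ξ else 0 := fun ν ξ => by
    simp [coeffAt_add, coeffAt_sum, coeffAt_term]
  have hcoeff_self : ∀ ν ∈ L, coeffAt (term ν 1 + ∑ μ ∈ S, term μ (c ν μ)) ν = 1 := fun ν hν => by
    rw [hcoeff, if_pos rfl, if_neg (hνS hν), add_zero]
  have hother : ∀ ν ξ, coeffAt (term ν 1 + ∑ μ ∈ S, term μ (c ν μ)) ξ ≠ 0 → ξ ≠ ν →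
      ξ ∈ S ∧ c ν ξ ≠ 0 := fun ν ξ h0 hne => by
    rw [hcoeff, if_neg (Ne.symm hne), zero_add] at h0
    by_cases hξ : ξ ∈ S
    · exact ⟨hξ, by simpa [hξ] using h0⟩
    · exact absurd (if_neg hξ) h0
  have hlead : ∀ ν ∈ L, IsLeadingMon ord (term ν 1 + ∑ μ ∈ S, term μ (c ν μ)) ν := fun ν hν =>
    ⟨by rw [hcoeff_self ν hν]; exact one_ne_zero, fun ξ h0 hne =>
      hlt ν hν ξ (hother ν ξ h0 hne).1 (hother ν ξ h0 hne).2⟩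
  have hsub : {f | ∃ ν ∈ L, f = term ν 1 + ∑ μ ∈ S, term μ (c ν μ)} ⊆
      (syzygyModule M hM F : Set (FreeMod K r m)) := by
    rintro _ ⟨ν, hν, rfl⟩
    change act M F _ = 0
    rw [act_add, act_sum, act_term, one_smul]
    simpa only [act_term] using hrel ν hν
  refine ⟨?_, hsub, le_antisymm ?_ ?_, ?_, ?_⟩
  · refine (L.finite_toSet.image fun ν => term ν 1 + ∑ μ ∈ S, term μ (c ν μ)).subset ?_
    rintro _ ⟨ν, hν, rfl⟩
    exact ⟨ν, hν, rfl⟩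
  · rw [Submodule.span_le]
    rintro _ ⟨f, hf, μ, hμ, rfl⟩
    have hμS : μ ∉ (S : Set (Mon r m)) := by
      rw [hS]
      exact hμ.notMem_standardMons hf
    obtain ⟨ν, hν, hd⟩ := exists_minimalOutside_divides ord hμS
    obtain ⟨κ, hκ⟩ := Mon.exists_mulBy hd
    have hνL : ν ∈ L := by
      rw [← hL] at hν
      exact hν
    have h1 : term μ (coeffAt f μ) = MvPolynomial.monomial κ (coeffAt f μ) •
        (term ν 1 : FreeMod K r m) := by
      rw [monomial_smul_term, mul_one, ← hκ]
    rw [h1]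
    refine Submodule.smul_mem _ _ (Submodule.subset_span
      ⟨_, ⟨ν, hνL, rfl⟩, ν, hlead ν hνL, ?_⟩)
    rw [hcoeff_self ν hνL]
  · refine Submodule.span_mono ?_
    rintro _ ⟨f, hf, h⟩
    exact ⟨f, hsub hf, h⟩
  · rintro _ ⟨ν, hν, rfl⟩
    exact ⟨ν, hlead ν hν, hcoeff_self ν hν⟩
  · rintro _ ⟨ν, hν, rfl⟩ _ ⟨ν', hν', rfl⟩ hne μ hμ ξ hξ hd
    obtain rfl := hμ.unique (hlead ν hν)
    by_cases hξν : ξ = ν'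
    · subst hξν
      refine hνS hν ((hL' hν').2 μ hd ?_)
      rintro rfl
      exact hne rfl
    · have hξS := (hother ν' ξ hξ hξν).1
      have hξS' : ξ ∈ standardMons K ord (monRow M F) Set.univ := hS ▸ hξS
      obtain ⟨κ, rfl⟩ := Mon.exists_mulBy hd
      have := (isEquivariant_monRow hM).mem_standardMons hξS' (Set.mem_univ μ)
        fun _ _ => Set.mem_univ _
      rw [← hS] at this
      exact hνS hν this

end Groebner

/-! ### Computing the standard monomials -/

section Standard

variable {K : Type u} [Field K] {ι : Type} {r m D : ℕ}

/-- The cost, in units of `n ^ ω`, of finding the pivots in `n` rows of length at most `n`. -/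
noncomputable def rankConst (ω c : ℝ) : ℝ := pivotConst ω c + mergeConst c

/-- Sort finitely many monomials and find the pivots in the matrix of their vectors. -/
theorem exists_sorted_pivots {ω c : ℝ} (hω : 2 < ω) (h : MatMulIn K ω c) (e : ℕ)
    (hD : D ≤ 2 ^ e) (q : ℕ) :
    ∃ p : (C : Finset (Mon r m)) → (Mon r m → Fin D → ι ⊕ ℕ) →
        Prog K ι (Mon r m × Mon r m) ((Fin C.card → Mon r m) × PivotOut ι C.card D),
      ∀ C : Finset (Mon r m), C.card ≤ q * 2 ^ e →
        ∀ (ord : ModuleMonomialOrder r m) (E : Env K ι (Mon r m × Mon r m)),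
          (∀ x, E.oracle x ↔ ord.lt x.1 x.2) →
          ∀ (s : Mem K) loc (φ : Mon r m → Fin D → K),
            (∀ μ ∈ C, ∀ j, Has E s (loc μ j) (φ μ j)) →
            Spec E s (p C loc) (q * (rankConst ω c * ((2 ^ e : ℕ) : ℝ) ^ ω)) fun o t =>
              (∀ i j, i < j → ord.lt (o.1 i) (o.1 j)) ∧ Set.range o.1 = C ∧
                PivotFound E (fun i => φ (o.1 i)) Finset.univ o.2 t := by
  classical
  have hp := fun (N : ℕ) (hN : N ≤ q * 2 ^ e) =>
    exists_pivots (ι := ι) (Q := Mon r m × Mon r m) hω h N D e hD q hN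
  choose p hp using hp
  -- the order of the sorted sequence is a function of the answers of the oracle
  let sort : (C : Finset (Mon r m)) → (Mon r m × Mon r m → Prop) → Fin C.card → Mon r m :=
    fun C R => if hσ : ∃ σ : Fin C.card → Mon r m, (∀ i j, i < j → R (σ i, σ j)) ∧
      Set.range σ = C then hσ.choose else fun i => C.equivFin.symm i
  refine ⟨fun C loc => if hC : C.card ≤ q * 2 ^ e then
      Prog.forEach Prog.ask (C ×ˢ C).toList >>= fun R =>
      p C.card hC (fun i => loc (sort C R i)) >>= fun o => pure (sort C R, o)
    else pure (fun i => C.equivFin.symm i, ∅, ∅, fun _ _ => .inr 0), ?_⟩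
  intro C hC ord E hE s loc φ hloc
  beta_reduce
  rw [dif_pos hC]
  refine (Spec.askAll (C ×ˢ C)).step fun R t hst hR => ?_
  have hRC : ∀ μ ∈ C, ∀ ν ∈ C, (R (μ, ν) ↔ ord.lt μ ν) := fun μ hμ ν hν =>
    (hR (μ, ν) (Finset.mem_product.2 ⟨hμ, hν⟩)).trans (hE _)
  have hex : ∃ σ : Fin C.card → Mon r m, (∀ i j, i < j → R (σ i, σ j)) ∧ Set.range σ = C := by
    obtain ⟨σ, h1, h2⟩ := ord.exists_enumeration C
    have hσC : ∀ i, σ i ∈ C := fun i => by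
      rw [← Finset.mem_coe, ← h2]
      exact ⟨i, rfl⟩
    exact ⟨σ, fun i j hij => (hRC _ (hσC i) _ (hσC j)).2 (h1 i j hij), h2⟩
  have hsort : sort C R = hex.choose := dif_pos hex
  have h1 := hex.choose_spec.1
  have h2 := hex.choose_spec.2
  rw [← hsort] at h1 h2
  have hσC : ∀ i, sort C R i ∈ C := fun i => by
    rw [← Finset.mem_coe, ← h2]
    exact ⟨i, rfl⟩
  refine (hp C.card hC E t (fun i => loc (sort C R i)) (fun i => φ (sort C R i))
    fun i _ j => (hloc _ (hσC i) j).mono hst).step fun o t' htt' ho => Spec.done ?_ ⟨?_, h2, ho⟩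
  · unfold rankConst
    linarith
  · exact fun i j hij => (hRC _ (hσC i) _ (hσC j)).1 (h1 i j hij)

/-- Select the standard monomials of a finite set. -/
theorem exists_select {ω c : ℝ} (hω : 2 < ω) (h : MatMulIn K ω c) (e : ℕ)
    (hD : D ≤ 2 ^ e) (q : ℕ) :
    ∃ p : Finset (Mon r m) → (Mon r m → Fin D → ι ⊕ ℕ) →
        Prog K ι (Mon r m × Mon r m) (Finset (Mon r m)),
      ∀ C : Finset (Mon r m), C.card ≤ q * 2 ^ e →
        ∀ (ord : ModuleMonomialOrder r m) (E : Env K ι (Mon r m × Mon r m)),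
          (∀ x, E.oracle x ↔ ord.lt x.1 x.2) →
          ∀ (s : Mem K) loc (φ : Mon r m → Fin D → K),
            (∀ μ ∈ C, ∀ j, Has E s (loc μ j) (φ μ j)) →
            Spec E s (p C loc) (q * (rankConst ω c * ((2 ^ e : ℕ) : ℝ) ^ ω)) fun S _ =>
              (S : Set (Mon r m)) = standardMons K ord φ C := by
  classical
  obtain ⟨p, hp⟩ := exists_sorted_pivots (ι := ι) (r := r) (m := m) hω h e hD q
  refine ⟨fun C loc => p C loc >>= fun o => pure (o.2.1.image o.1), ?_⟩
  intro C hC ord E hE s loc φ hloc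
  refine (hp C hC ord E hE s loc φ hloc).step fun o t _ ho => Spec.done (by simp) ?_
  obtain ⟨h1, h2, W, hW, -⟩ := ho
  rw [Finset.coe_image, hW.image_eq_standardMons h1 (φ := φ) fun _ => rfl, h2]

/-- The cost, in units of `n ^ ω`, of doubling the degree bound in one variable. -/
noncomputable def doublingConst (ω c : ℝ) : ℝ := 2 * (|c| + rankConst ω c)

theorem rankConst_pos {ω : ℝ} (hω : 2 < ω) (c : ℝ) : 0 < rankConst ω c := by
  have := two_le_pivotConst hω c
  have := mergeConst_pos c
  unfold rankConst
  linarith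

/-- One doubling step: from the standard monomials of degree less than `b` in the variable `k` and
the `b`-th power of the matrix, find those for `2 * b`. -/
theorem exists_doubling {ω c : ℝ} (hω : 2 < ω) (h : MatMulIn K ω c) (e : ℕ)
    (hD : D ≤ 2 ^ e) (k : Fin r) :
    ∃ p : ℕ → Finset (Mon r m) → (Mon r m → Fin D → ι ⊕ ℕ) → (Fin D → Fin D → ι ⊕ ℕ) →
        Prog K ι (Mon r m × Mon r m)
          (Finset (Mon r m) × (Mon r m → Fin D → ι ⊕ ℕ) × (Fin D → Fin D → ι ⊕ ℕ)),
      ∀ (M : Fin r → Matrix (Fin D) (Fin D) K), (∀ i j, Commute (M i) (M j)) →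
        ∀ (F : Matrix (Fin m) (Fin D) K) (ord : ModuleMonomialOrder r m)
          (E : Env K ι (Mon r m × Mon r m)), (∀ x, E.oracle x ↔ ord.lt x.1 x.2) →
        ∀ (b : ℕ) (s : Mem K) (S : Finset (Mon r m)) loc pw,
          (S : Set (Mon r m)) = standardMons K ord (monRow M F) (degLT m k b) →
          (∀ μ ∈ S, ∀ j, Has E s (loc μ j) (monRow M F μ j)) →
          (∀ i j, Has E s (pw i j) ((M k ^ b) i j)) →
          Spec E s (p b S loc pw) (doublingConst ω c * ((2 ^ e : ℕ) : ℝ) ^ ω) fun o t =>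
            (o.1 : Set (Mon r m)) = standardMons K ord (monRow M F) (degLT m k (2 * b)) ∧
            (∀ μ ∈ o.1, ∀ j, Has E t (o.2.1 μ j) (monRow M F μ j)) ∧
            ∀ i j, Has E t (o.2.2 i j) ((M k ^ (2 * b)) i j) := by
  classical
  obtain ⟨sel, hsel⟩ := exists_select (K := K) (ι := ι) (r := r) (m := m) hω h e hD 2
  obtain ⟨mulR, hmulR⟩ := exists_mul (ι := ι) (Q := Mon r m × Mon r m) h (2 ^ e) 1 1
    (Mon r m) (Fin D) (Fin D)
  obtain ⟨mulM, hmulM⟩ := exists_mul (ι := ι) (Q := Mon r m × Mon r m) h (2 ^ e) 1 1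
    (Fin D) (Fin D) (Fin D)
  let shift : ℕ → Mon r m → Mon r m := fun b μ => μ.mulBy (Finsupp.single k b)
  let unshift : ℕ → Mon r m → Mon r m := fun b μ => (μ.1, μ.2 - Finsupp.single k b)
  have hunshift : ∀ b μ, unshift b (shift b μ) = μ := fun b μ =>
    Prod.ext rfl (add_tsub_cancel_left (Finsupp.single k b) μ.2)
  refine ⟨fun b S loc pw => mulR S Finset.univ Finset.univ loc pw >>= fun rows =>
    sel (S ∪ S.image (shift b)) (fun ν => if ν ∈ S then loc ν else rows (unshift b ν)) >>=
      fun S' =>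
    mulM Finset.univ Finset.univ Finset.univ pw pw >>= fun pw' =>
    pure (S', (fun ν => if ν ∈ S then loc ν else rows (unshift b ν)), pw'), ?_⟩
  intro M hM F ord E hE b s S loc pw hS hloc hpw
  have huniv : (Finset.univ : Finset (Fin D)).card ≤ 2 ^ e := by simpa using hD
  have hScard : S.card ≤ 2 ^ e := by
    have := card_le_finrank_of_subset_standardMons hS.le
    rw [Module.finrank_fin_fun] at this
    exact this.trans hD
  have hCcard : (S ∪ S.image (shift b)).card ≤ 2 * 2 ^ e :=
    (Finset.card_union_le _ _).trans (by have := Finset.card_image_le (s := S) (f := shift b); omega)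
  refine (hmulR S Finset.univ Finset.univ (by simpa using hScard) huniv (by simpa using hD) E s
    loc pw (monRow M F) (M k ^ b) (fun μ hμ j _ => hloc μ hμ j) fun i _ j _ => hpw i j).step
    fun rows t hst hrows => ?_
  have hlocC : ∀ μ ∈ S ∪ S.image (shift b), ∀ j,
      Has E t ((if μ ∈ S then loc μ else rows (unshift b μ)) j) (monRow M F μ j) := by
    intro μ hμ j
    by_cases hμS : μ ∈ S
    · rw [if_pos hμS]
      exact (hloc μ hμS j).mono hst
    · obtain ⟨ν, hν, rfl⟩ := Finset.mem_image.1 ((Finset.mem_union.1 hμ).resolve_left hμS)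
      rw [if_neg hμS, hunshift]
      have h1 := hrows ν hν j (Finset.mem_univ _)
      have h2 : monRow M F (shift b ν) j = ∑ i, monRow M F ν i * (M k ^ b) i j := by
        simp only [shift, monRow_mulBy_single hM, Matrix.vecMul, dotProduct]
      rwa [h2]
  refine (hsel _ hCcard ord E hE t _ _ hlocC).step fun S' t' htt' hS' => ?_
  refine (hmulM Finset.univ Finset.univ Finset.univ (by simpa using hD) huniv (by simpa using hD)
    E t' pw pw (M k ^ b) (M k ^ b) (fun i _ j _ => (hpw i j).mono (hst.trans htt'))
    fun i _ j _ => (hpw i j).mono (hst.trans htt')).step fun pw' t₃ ht₃ hpw' =>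
      Spec.done ?_ ⟨?_, ?_, ?_⟩
  · have h0 : (0 : ℝ) ≤ ((2 ^ e : ℕ) : ℝ) ^ ω := by positivity
    have h1 := mul_le_mul_of_nonneg_right (le_abs_self c) h0
    simp only [doublingConst, Nat.cast_one, one_mul, Nat.cast_ofNat]
    linarith
  · rw [hS']
    refine standardMons_eq_of_subset ?_ ?_
    · rw [Finset.coe_union, Finset.coe_image, hS]
      exact (isEquivariant_monRow hM).standardMons_degLT_subset k b
    · intro μ hμ
      rcases Finset.mem_union.1 hμ with hμ | hμ
      · rw [← Finset.mem_coe, hS] at hμ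
        exact ⟨hμ.1.1, by have := hμ.1.2; omega⟩
      · obtain ⟨ν, hν, rfl⟩ := Finset.mem_image.1 hμ
        rw [← Finset.mem_coe, hS] at hν
        refine ⟨mulBy_single_mem_firstVars b hν.1.1, ?_⟩
        have := hν.1.2
        simp only [shift, Mon.mulBy, Finsupp.add_apply, Finsupp.single_eq_same]
        omega
  · intro μ hμ j
    have hμC : μ ∈ S ∪ S.image (shift b) := by
      rw [← Finset.mem_coe, hS'] at hμ
      exact hμ.1
    exact (hlocC μ hμC j).mono (htt'.trans ht₃)
  · intro i j
    have h1 := hpw' i (Finset.mem_univ _) j (Finset.mem_univ _)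
    rwa [two_mul, pow_add, Matrix.mul_apply]

/-- All doubling steps for one variable. The loop ends when the standard monomials do not change;
at the latest, this happens in the step after the degree bound has reached the degree of the
minimal polynomial. -/
theorem exists_doublings {ω c : ℝ} (hω : 2 < ω) (h : MatMulIn K ω c) (e : ℕ)
    (hD : D ≤ 2 ^ e) (k : Fin r) (fuel : ℕ) :
    ∃ p : ℕ → Finset (Mon r m) → (Mon r m → Fin D → ι ⊕ ℕ) → (Fin D → Fin D → ι ⊕ ℕ) →
        Prog K ι (Mon r m × Mon r m) (Finset (Mon r m) × (Mon r m → Fin D → ι ⊕ ℕ)),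
      ∀ (M : Fin r → Matrix (Fin D) (Fin D) K), (∀ i j, Commute (M i) (M j)) →
        ∀ (F : Matrix (Fin m) (Fin D) K) (ord : ModuleMonomialOrder r m)
          (E : Env K ι (Mon r m × Mon r m)), (∀ x, E.oracle x ↔ ord.lt x.1 x.2) →
        ∀ (g l : ℕ) (s : Mem K) (S : Finset (Mon r m)) loc pw, g ≤ fuel →
          (minpoly K (M k)).natDegree ≤ 2 ^ (l + g) →
          (S : Set (Mon r m)) = standardMons K ord (monRow M F) (degLT m k (2 ^ l)) →
          (∀ μ ∈ S, ∀ j, Has E s (loc μ j) (monRow M F μ j)) →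
          (∀ i j, Has E s (pw i j) ((M k ^ 2 ^ l) i j)) →
          Spec E s (p l S loc pw) ((g + 1) * (doublingConst ω c * ((2 ^ e : ℕ) : ℝ) ^ ω)) fun o t =>
            (o.1 : Set (Mon r m)) = standardMons K ord (monRow M F) (firstVars r m (k + 1)) ∧
            ∀ μ ∈ o.1, ∀ j, Has E t (o.2 μ j) (monRow M F μ j) := by
  classical
  have hpos : 0 ≤ doublingConst ω c * ((2 ^ e : ℕ) : ℝ) ^ ω := by
    have := rankConst_pos hω c
    unfold doublingConst
    positivity
  obtain ⟨dbl, hdbl⟩ := exists_doubling (K := K) (ι := ι) (m := m) hω h e hD k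
  induction fuel with
  | zero =>
    refine ⟨fun _ S loc _ => pure (S, loc), ?_⟩
    intro M hM F ord E hE g l s S loc pw hg hd hS hloc hpw
    obtain rfl : g = 0 := by omega
    refine Spec.done (by simpa using hpos) ⟨?_, hloc⟩
    rw [hS, standardMons_firstVars_eq hM ord k hd]
    rfl
  | succ fuel ih =>
    obtain ⟨p, hp⟩ := ih
    refine ⟨fun l S loc pw => dbl (2 ^ l) S loc pw >>= fun o =>
      if o.1 = S then pure (S, loc) else p (l + 1) o.1 o.2.1 o.2.2, ?_⟩
    intro M hM F ord E hE g l s S loc pw hg hd hS hloc hpw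
    refine (hdbl M hM F ord E hE (2 ^ l) s S loc pw hS hloc hpw).step ?_
    rintro ⟨S', loc', pw'⟩ t hst ⟨hS', hloc', hpw'⟩
    dsimp only at hS' hloc' hpw' ⊢
    split_ifs with heq
    · refine Spec.done ?_ ⟨?_, fun μ hμ j => (hloc μ hμ j).mono hst⟩
      · have : 0 ≤ (g : ℝ) * (doublingConst ω c * ((2 ^ e : ℕ) : ℝ) ^ ω) := by positivity
        linarith
      · rw [hS, ← (isEquivariant_monRow hM).standardMons_of_stable Nat.one_le_two_pow]
        rw [← hS', heq, hS]
    · cases g with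
      | zero =>
        exfalso
        rw [add_zero] at hd
        refine heq (Finset.coe_injective ?_)
        rw [hS, hS', ← standardMons_firstVars_eq hM ord k hd,
          ← standardMons_firstVars_eq hM ord k (hd.trans (by omega))]
      | succ g =>
        refine (hp M hM F ord E hE g (l + 1) t S' loc' pw' (by omega)
          (hd.trans_eq (by congr 1; omega)) (by rw [hS', pow_succ']) hloc'
          (by rwa [pow_succ'])).mono (by push_cast; linarith) fun _ _ _ h => h

/-- The standard monomials in the first `i` variables, with their vectors. -/
theorem exists_standard {ω c : ℝ} (hω : 2 < ω) (h : MatMulIn K ω c) (e : ℕ)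
    (hD : D ≤ 2 ^ e) (q : ℕ) (hm : m ≤ q * 2 ^ e) (i : ℕ) (hi : i ≤ r) :
    ∃ p : Prog K (SyzygyInput r m D) (Mon r m × Mon r m)
        (Finset (Mon r m) × (Mon r m → Fin D → SyzygyInput r m D ⊕ ℕ)),
      ∀ (M : Fin r → Matrix (Fin D) (Fin D) K), (∀ i j, Commute (M i) (M j)) →
        ∀ (F : Matrix (Fin m) (Fin D) K) (ord : ModuleMonomialOrder r m)
          (E : Env K (SyzygyInput r m D) (Mon r m × Mon r m)), E.input = syzygyInput M F →
          (∀ x, E.oracle x ↔ ord.lt x.1 x.2) → (∀ k, (minpoly K (M k)).natDegree ≤ D) →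
        ∀ s : Mem K,
          Spec E s p (q * (rankConst ω c * ((2 ^ e : ℕ) : ℝ) ^ ω) +
            ∑ k : Fin r with k.val < i, ((Nat.clog 2 (minpoly K (M k)).natDegree : ℝ) + 1) *
              (doublingConst ω c * ((2 ^ e : ℕ) : ℝ) ^ ω)) fun o t =>
            (o.1 : Set (Mon r m)) = standardMons K ord (monRow M F) (firstVars r m i) ∧
            ∀ μ ∈ o.1, ∀ j, Has E t (o.2 μ j) (monRow M F μ j) := by
  classical
  induction i with
  | zero =>
    obtain ⟨sel, hsel⟩ :=
      exists_select (K := K) (ι := SyzygyInput r m D) (r := r) (m := m) hω h e hD q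
    refine ⟨sel (Finset.univ.image fun i => (i, 0)) (fun μ j => .inl (.inr (μ.1, j))) >>= fun S =>
      pure (S, fun μ j => .inl (.inr (μ.1, j))), ?_⟩
    intro M hM F ord E hin hE hd s
    have hmem : ∀ μ : Mon r m, μ ∈ (Finset.univ.image fun i : Fin m => ((i, 0) : Mon r m)) ↔
        μ ∈ firstVars r m 0 := by
      intro μ
      simp only [Finset.mem_image, Finset.mem_univ, true_and, firstVars, Set.mem_ofPred_eq]
      constructor
      · rintro ⟨i, rfl⟩ j _
        rfl
      · intro h0
        exact ⟨μ.1, Prod.ext rfl (Finsupp.ext fun j => (h0 j (Nat.zero_le _)).symm)⟩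
    have hloc : ∀ t, ∀ μ ∈ firstVars r m 0, ∀ j,
        Has E t (.inl (.inr (μ.1, j))) (monRow M F μ j) := by
      intro t μ hμ j
      have h0 : μ.2 = 0 := Finsupp.ext fun j => hμ j (Nat.zero_le _)
      change E.input _ = _
      rw [hin, monRow, h0, matPow_zero, Matrix.vecMul_one]
      rfl
    refine (hsel _ ?_ ord E hE s _ (monRow M F) fun μ hμ => hloc s μ ((hmem μ).1 hμ)).step
      fun S t hst hS => Spec.done (by simp) ⟨?_, fun μ hμ => hloc t μ ?_⟩
    · exact Finset.card_image_le.trans (by simpa using hm)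
    · rw [hS]
      congr 1
      ext μ
      exact hmem μ
    · rw [← Finset.mem_coe, hS] at hμ
      exact (hmem μ).1 hμ.1
  | succ i ih =>
    obtain ⟨p, hp⟩ := ih (by omega)
    set k : Fin r := ⟨i, hi⟩ with hk
    obtain ⟨dbl, hdbl⟩ := exists_doublings (K := K) (ι := SyzygyInput r m D) (m := m) hω h e hD k
      (Nat.clog 2 D)
    refine ⟨p >>= fun o => dbl 0 o.1 o.2 fun a b => .inl (.inl (k, a, b)), ?_⟩
    intro M hM F ord E hin hE hd s
    refine ((hp M hM F ord E hin hE hd s).bind fun o t hst ho =>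
      hdbl M hM F ord E hE (Nat.clog 2 (minpoly K (M k)).natDegree) 0 t o.1 o.2 _
        (Nat.clog_mono_right 2 (hd k)) ?_ ?_ ho.2 ?_).mono ?_ fun _ _ _ h => h
    · rw [zero_add]
      exact Nat.le_pow_clog (by norm_num) _
    · rw [ho.1, pow_zero, degLT_one]
    · intro a b
      change E.input _ = _
      rw [hin, pow_zero, pow_one]
      rfl
    · have hfilter : (Finset.univ.filter fun j : Fin r => (j : ℕ) < i + 1) =
          insert k (Finset.univ.filter fun j : Fin r => (j : ℕ) < i) := by
        ext j
        simp only [Finset.mem_filter, Finset.mem_univ, true_and, Finset.mem_insert, hk,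
          Fin.ext_iff]
        omega
      rw [hfilter, Finset.sum_insert (by simp [hk])]
      linarith

end Standard

/-! ### Computing the Gröbner basis -/

section Output

variable {K : Type u} [Field K] {r m D : ℕ}

/-- The elements of the free module described by an output. -/
noncomputable def elementsOf {ι : Type} (val : ι ⊕ ℕ → K) (out : List (List (Mon r m × (ι ⊕ ℕ)))) :
    Set (FreeMod K r m) :=
  {f | ∃ l ∈ out, f = (l.map fun t => term t.1 (val t.2)).sum}

open Classical in
/-- The finite set of the minimal monomials outside `S`. -/
noncomputable def minimalOutsideFinset (S : Finset (Mon r m)) : Finset (Mon r m) :=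
  ((Finset.univ.image fun i => ((i, 0) : Mon r m)) ∪
    Finset.univ.biUnion fun k => S.image fun μ => μ.mulBy (Finsupp.single k 1)).filter
      (· ∈ minimalOutside (S : Set (Mon r m)))

theorem coe_minimalOutsideFinset (S : Finset (Mon r m)) :
    (minimalOutsideFinset S : Set (Mon r m)) = minimalOutside (S : Set (Mon r m)) := by
  classical
  ext ν
  simp only [minimalOutsideFinset, Finset.coe_filter, Finset.mem_union, Finset.mem_image,
    Finset.mem_univ, true_and, Finset.mem_biUnion, Set.mem_ofPred_eq, and_iff_right_iff_imp]
  intro h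
  rcases eq_zero_or_exists_of_minimalOutside h with h0 | ⟨k, μ, hμ, rfl⟩
  · exact Or.inl ⟨ν.1, Prod.ext rfl h0.symm⟩
  · exact Or.inr ⟨k, μ, hμ, rfl⟩

/-- From the standard monomials and their vectors, compute the reduced Gröbner basis. -/
theorem exists_output {ω c : ℝ} (hω : 2 < ω) (h : MatMulIn K ω c) (e : ℕ)
    (hD : D ≤ 2 ^ e) (q : ℕ) (hm : m ≤ q * 2 ^ e) :
    ∃ p : Finset (Mon r m) → (Mon r m → Fin D → SyzygyInput r m D ⊕ ℕ) →
        Prog K (SyzygyInput r m D) (Mon r m × Mon r m) (SyzygyOutput r m D),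
      ∀ (M : Fin r → Matrix (Fin D) (Fin D) K) (hM : ∀ i j, Commute (M i) (M j))
        (F : Matrix (Fin m) (Fin D) K) (ord : ModuleMonomialOrder r m)
          (E : Env K (SyzygyInput r m D) (Mon r m × Mon r m)), E.input = syzygyInput M F →
          (∀ x, E.oracle x ↔ ord.lt x.1 x.2) →
        ∀ (s : Mem K) (S : Finset (Mon r m)) loc,
          (S : Set (Mon r m)) = standardMons K ord (monRow M F) Set.univ →
          (∀ μ ∈ S, ∀ j, Has E s (loc μ j) (monRow M F μ j)) →
          Spec E s (p S loc) ((rankConst ω c + 1 + (q + 2 * r) * |c|) * ((2 ^ e : ℕ) : ℝ) ^ ω)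
            fun o t => IsReducedGroebnerBasis ord (syzygyModule M hM F)
              (elementsOf (Sum.elim E.input t.val) o) := by
  classical
  obtain ⟨srt, hsrt⟩ :=
    exists_sorted_pivots (K := K) (ι := SyzygyInput r m D) (r := r) (m := m) hω h e hD 1
  have hmulF := fun N : ℕ => exists_mul (ι := SyzygyInput r m D) (Q := Mon r m × Mon r m) h
    (2 ^ e) q 1 (Fin m) (Fin D) (Fin N)
  choose mulF hmulF using hmulF
  obtain ⟨mulR, hmulR⟩ := exists_mul (ι := SyzygyInput r m D) (Q := Mon r m × Mon r m) h
    (2 ^ e) 1 1 (Mon r m) (Fin D) (Fin D)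
  have hmulW := fun N : ℕ => exists_mul (ι := SyzygyInput r m D) (Q := Mon r m × Mon r m) h
    (2 ^ e) 1 1 (Mon r m) (Fin D) (Fin N)
  choose mulW hmulW using hmulW
  -- the place of the coefficients of the normal form of a minimal monomial outside `S`
  let place : (S : Finset (Mon r m)) → {N : ℕ} → (Fin m → Fin N → SyzygyInput r m D ⊕ ℕ) →
      (Fin r → Mon r m → Fin N → SyzygyInput r m D ⊕ ℕ) → Mon r m → Fin N →
      SyzygyInput r m D ⊕ ℕ := fun S N cF cR ν =>
    if ν.2 = 0 then cF ν.1 else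
      if hν : ∃ k : Fin r, ∃ μ ∈ S, ν = μ.mulBy (Finsupp.single k 1) then
        cR hν.choose hν.choose_spec.choose else fun _ => .inr 0
  let _ : ∀ N, Inhabited (Mon r m → Fin N → SyzygyInput r m D ⊕ ℕ) := fun N =>
    ⟨fun _ _ => .inr 0⟩
  refine ⟨fun S loc => Prog.const 0 >>= fun z => Prog.const 1 >>= fun one =>
    srt S loc >>= fun o =>
    Prog.zipWith .sub Finset.univ Finset.univ (fun _ _ => z)
      (fun i j => if i ∈ o.2.2.1 ∧ j ∈ o.2.1 then o.2.2.2 i j else z) >>= fun w =>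
    mulF S.card Finset.univ Finset.univ Finset.univ (fun i j => .inl (.inr (i, j))) w >>= fun cF =>
    Prog.forEach (fun k : Fin r =>
      mulR S Finset.univ Finset.univ loc (fun i j => .inl (.inl (k, i, j))) >>= fun rows =>
      mulW S.card S Finset.univ Finset.univ rows w)
      (Finset.univ : Finset (Fin r)).toList >>= fun cR =>
    pure ((minimalOutsideFinset S).toList.map fun ν => (ν, one) ::
      (List.finRange S.card).map fun p => (o.1 p, place S cF cR ν p)), ?_⟩
  intro M hM F ord E hin hE s S loc hS hloc
  have hScard : S.card ≤ 2 ^ e := by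
    have := card_le_finrank_of_subset_standardMons hS.le
    rw [Module.finrank_fin_fun] at this
    exact this.trans hD
  have hcost : 0 ≤ ((2 ^ e : ℕ) : ℝ) ^ ω := by positivity
  have hcost' := mul_le_mul_of_nonneg_right (le_abs_self c) hcost
  refine (Spec.const 0).step fun z t₀ hs₀ hz => (Spec.const 1).step fun one t₁ hs₁ hone => ?_
  refine (hsrt S (by simpa using hScard) ord E hE t₁ loc (monRow M F)
    fun μ hμ j => (hloc μ hμ j).mono (hs₀.trans hs₁)).step ?_
  rintro ⟨σ, P, Q, w₀⟩ t₂ hs₂ ⟨hσ, hrange, W, hW, hw₀⟩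
  dsimp only at hσ hrange hW hw₀ ⊢
  refine ((Spec.zipWith (f := fun u v => u - v) (A := fun _ _ => 0) (B := W) (fun _ _ => rfl)
    (fun _ _ _ _ => hz.mono (hs₁.trans hs₂)) fun i _ j _ => ?_).mono
    (b' := ((2 ^ e : ℕ) : ℝ) ^ ω) ?_ fun _ _ _ h => h).step fun w t₃ hs₃ hw => ?_
  · split_ifs with hij
    · exact hw₀ i hij.1 j hij.2
    · rw [hW.support i j hij]
      exact hz.mono (hs₁.trans hs₂)
  · refine le_trans ?_ (sq_le_rpow hω _)
    have h1 : (D : ℝ) ≤ ((2 ^ e : ℕ) : ℝ) := by exact_mod_cast hD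
    have h2 : (S.card : ℝ) ≤ ((2 ^ e : ℕ) : ℝ) := by exact_mod_cast hScard
    simp only [Finset.card_univ, Fintype.card_fin]
    exact mul_le_mul h1 h2 (by positivity) (by positivity)
  have hDuniv : (Finset.univ : Finset (Fin D)).card ≤ 2 ^ e := by simpa using hD
  refine (hmulF S.card Finset.univ Finset.univ Finset.univ (by simpa using hm) hDuniv
    (by simpa using hScard) E t₃ (fun i j => .inl (.inr (i, j))) w F (fun i j => 0 - W i j)
    (fun i _ j _ => ?_) hw).step fun cF t₄ hs₄ hcF => ?_
  · change E.input _ = _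
    rw [hin]
    rfl
  refine ((Spec.forEach (b := 2 * (|c| * ((2 ^ e : ℕ) : ℝ) ^ ω))
    (P := fun (k : Fin r) (g : Mon r m → Fin S.card → SyzygyInput r m D ⊕ ℕ) t =>
      ∀ μ ∈ S, ∀ p, Has E t (g μ p)
        (∑ j, monRow M F (μ.mulBy (Finsupp.single k 1)) j * (0 - W j p)))
    (fun _ _ _ _ htt' hP μ hμ p => (hP μ hμ p).mono htt') Finset.univ
    fun k _ t hst => ?_)).step fun cR t₅ hs₅ hcR => Spec.done ?_ ?_
  · refine (hmulR S Finset.univ Finset.univ (by simpa using hScard) hDuniv (by simpa using hD) E t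
      loc (fun i j => .inl (.inl (k, i, j))) (monRow M F) (M k) (fun μ hμ j _ => (hloc μ hμ j).mono
        (hs₀.trans (hs₁.trans (hs₂.trans (hs₃.trans (hs₄.trans hst))))))
      fun i _ j _ => ?_).step fun rows t' htt' hrows => ?_
    · change E.input _ = _
      rw [hin]
      rfl
    · refine (hmulW S.card S Finset.univ Finset.univ (by simpa using hScard) hDuniv
        (by simpa using hScard) E t' rows w
        (fun μ j => monRow M F (μ.mulBy (Finsupp.single k 1)) j)
        (fun i j => 0 - W i j) (fun μ hμ j hj => ?_)
        fun i hi j hj => (hw i hi j hj).mono (hs₄.trans (hst.trans htt'))).mono ?_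
        fun g t'' _ hg μ hμ p => hg μ hμ p (Finset.mem_univ _)
      · have h1 := hrows μ hμ j hj
        rw [monRow_mulBy_single hM, pow_one]
        exact h1
      · simp only [Nat.cast_one, one_mul]
        linarith
  · have h1 := mul_le_mul_of_nonneg_left hcost' (Nat.cast_nonneg (α := ℝ) q)
    simp only [Finset.card_univ, Fintype.card_fin, Nat.cast_one, one_mul]
    linarith
  · have hinj : Function.Injective σ := fun i j hij => by
      by_contra hne
      rcases lt_or_gt_of_ne hne with h | h
      · exact ord.irrefl _ (hij ▸ hσ _ _ h)
      · exact ord.irrefl _ (hij ▸ hσ _ _ h)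
    have hσS : ∀ {β : Type u} [AddCommMonoid β] (f : Mon r m → β),
        ∑ μ ∈ S, f μ = ∑ p, f (σ p) := by
      intro β _ f
      have : S = Finset.univ.image σ := by
        rw [← Finset.coe_inj, Finset.coe_image, Finset.coe_univ, Set.image_univ, hrange]
      conv_lhs => rw [this]
      rw [Finset.sum_image fun i _ j _ hij => hinj hij]
    have hL : ∀ {ν}, ν ∈ minimalOutsideFinset S → ν ∈ minimalOutside (S : Set (Mon r m)) :=
      fun hν => coe_minimalOutsideFinset S ▸ hν
    have hnf := fun ν (hν : ν ∈ minimalOutsideFinset S) =>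
      hW.normalForm (φ := monRow M F) hσ (by rw [hrange, hS]) (fun _ => rfl) (ν := ν)
        (hS ▸ (hL hν).1)
    let cf : Mon r m → Mon r m → K := fun ν =>
      Function.extend σ (fun p => -Matrix.vecMul (monRow M F ν) W p) 0
    have hcf : ∀ ν p, cf ν (σ p) = -Matrix.vecMul (monRow M F ν) W p := fun ν p =>
      hinj.extend_apply _ _ p
    have hplace : ∀ ν ∈ minimalOutsideFinset S, ∀ p,
        Sum.elim E.input t₅.val (place S cF cR ν p) = cf ν (σ p) := by
      intro ν hν p
      have hsum : ∀ v : Fin D → K, ∑ j, v j * (0 - W j p) = -Matrix.vecMul v W p := fun v => by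
        simp [Matrix.vecMul, dotProduct]
      rw [hcf, ← hsum]
      refine Has.value_eq ?_
      by_cases h0 : ν.2 = 0
      · have h1 := (hcF ν.1 (Finset.mem_univ _) p (Finset.mem_univ _)).mono hs₅
        have h2 : monRow M F ν = F ν.1 := by
          rw [monRow, h0, matPow_zero, Matrix.vecMul_one]
        simp only [place, if_pos h0, h2]
        exact h1
      · have hex := (eq_zero_or_exists_of_minimalOutside (hL hν)).resolve_left h0
        have hex' : ∃ k : Fin r, ∃ μ ∈ S, ν = μ.mulBy (Finsupp.single k 1) := hex
        have h1 := hcR hex'.choose (Finset.mem_univ _) hex'.choose_spec.choose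
          hex'.choose_spec.choose_spec.1 p
        rw [← hex'.choose_spec.choose_spec.2] at h1
        simp only [place, if_neg h0, dif_pos hex']
        exact h1
    convert isReducedGroebnerBasis_of_normalForms hM (ord := ord) (F := F) hS
      (coe_minimalOutsideFinset S) (c := cf) ?_ ?_ using 1
    · ext f
      simp only [elementsOf, List.mem_map, Finset.mem_toList, Set.mem_ofPred_eq,
        exists_exists_and_eq_and]
      refine exists_congr fun ν => and_congr_right fun hν => ?_
      rw [List.map_cons, List.sum_cons, List.map_map, hσS]
      have h1 : Sum.elim E.input t₅.val one = 1 :=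
        (hone.mono (hs₂.trans (hs₃.trans (hs₄.trans hs₅)))).value_eq
      rw [h1, ← List.ofFn_eq_map, List.sum_ofFn]
      simp only [Function.comp_apply, hplace ν hν]
    · intro ν hν μ hμ h0
      rw [← Finset.mem_coe, ← hrange] at hμ
      obtain ⟨p, rfl⟩ := hμ
      rw [hcf, neg_ne_zero] at h0
      exact (hnf ν hν).2 p h0
    · intro ν hν
      rw [hσS]
      simp only [hcf, neg_smul, Finset.sum_neg_distrib]
      rw [← (hnf ν hν).1, add_neg_cancel]

end Output

/-! ### The total cost -/

section Total

variable {K : Type u} [Field K] {r m D : ℕ}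

theorem natDegree_minpoly_mem_Icc (hD : 1 ≤ D) (A : Matrix (Fin D) (Fin D) K) :
    (minpoly K A).natDegree ∈ Set.Icc 1 D := by
  have : Nonempty (Fin D) := ⟨⟨0, hD⟩⟩
  refine ⟨minpoly.natDegree_pos (Matrix.isIntegral A), ?_⟩
  have h1 := Polynomial.natDegree_le_of_dvd (Matrix.minpoly_dvd_charpoly A)
    (Matrix.charpoly_monic A).ne_zero
  rwa [Matrix.charpoly_natDegree_eq_dim, Fintype.card_fin] at h1

theorem clog_two_le {d : ℕ} (hd : 1 ≤ d) : (Nat.clog 2 d : ℝ) ≤ 1 + 2 * Real.log d := by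
  rcases Nat.eq_or_lt_of_le hd with rfl | hd
  · simp
  · have h1 : 2 ^ (Nat.clog 2 d - 1) < d := Nat.pow_pred_clog_lt_self (by norm_num) hd
    have h2 : 1 ≤ Nat.clog 2 d := Nat.clog_pos (by norm_num) hd
    have h3 : ((Nat.clog 2 d - 1 : ℕ) : ℝ) * Real.log 2 ≤ Real.log d := by
      rw [← Real.log_pow]
      exact Real.log_le_log (by positivity) (by exact_mod_cast h1.le)
    rw [Nat.cast_sub h2, Nat.cast_one] at h3
    have h4 := Real.log_two_gt_d9
    have h5 : (0 : ℝ) ≤ (Nat.clog 2 d : ℝ) - 1 := by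
      rw [sub_nonneg]
      exact_mod_cast h2
    nlinarith

theorem log_prod_natCast_nonneg {d : Fin r → ℕ} (hd : ∀ k, 1 ≤ d k) :
    0 ≤ Real.log (∏ k, (d k : ℝ)) := by
  rw [Real.log_prod fun k _ => by have := hd k; positivity]
  exact Finset.sum_nonneg fun k _ => Real.log_natCast_nonneg _

/-- The sizes are padded to a power of two below `2 * D`, and the rows of `F` are treated in
blocks of this size. -/
theorem cost_le {ω : ℝ} (hω : 2 < ω) (c : ℝ) {D m r : ℕ} (hD : 1 ≤ D) (hr : 1 ≤ r) {d : Fin r → ℕ}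
    (hd : ∀ k, 1 ≤ d k) {e q : ℕ} (he : 2 ^ e ≤ 2 * D)
    (hq : q * 2 ^ e ≤ m + 2 ^ e) :
    (q * (rankConst ω c * ((2 ^ e : ℕ) : ℝ) ^ ω) + ∑ k : Fin r, ((Nat.clog 2 (d k) : ℝ) + 1) *
      (doublingConst ω c * ((2 ^ e : ℕ) : ℝ) ^ ω)) +
      (rankConst ω c + 1 + (q + 2 * r) * |c|) * ((2 ^ e : ℕ) : ℝ) ^ ω ≤
    10 * ((|c| + rankConst ω c + 1) * 2 ^ ω) * ((m : ℝ) * (D : ℝ) ^ (ω - 1) +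
      (D : ℝ) ^ ω * (r + Real.log (∏ k, (d k : ℝ)))) := by
  set ℓ := Real.log (∏ k, (d k : ℝ)) with hℓ
  have hsum : ∑ k : Fin r, ((Nat.clog 2 (d k) : ℝ) + 1) ≤ 2 * r + 2 * ℓ := by
    rw [hℓ, Real.log_prod fun k _ => by have := hd k; positivity, Finset.mul_sum]
    calc _ ≤ ∑ k : Fin r, (2 + 2 * Real.log (d k)) :=
          Finset.sum_le_sum fun k _ => by have := clog_two_le (hd k); linarith
      _ = _ := by
          rw [Finset.sum_add_distrib]
          simp
          ring
  have hℓ0 : 0 ≤ ℓ := log_prod_natCast_nonneg hd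
  have hrank := rankConst_pos hω c
  have hDpos : (0 : ℝ) < D := by exact_mod_cast hD
  have hr' : (1 : ℝ) ≤ r := by exact_mod_cast hr
  have hnpos : (0 : ℝ) < ((2 ^ e : ℕ) : ℝ) := by positivity
  have hn : ((2 ^ e : ℕ) : ℝ) ≤ 2 * D := by exact_mod_cast he
  have hX : ((2 ^ e : ℕ) : ℝ) ^ ω ≤ 2 ^ ω * (D : ℝ) ^ ω := by
    rw [← Real.mul_rpow (by norm_num) hDpos.le]
    exact Real.rpow_le_rpow hnpos.le hn (by linarith)
  have hY : ((2 ^ e : ℕ) : ℝ) ^ (ω - 1) ≤ 2 ^ ω * (D : ℝ) ^ (ω - 1) := by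
    calc ((2 ^ e : ℕ) : ℝ) ^ (ω - 1) ≤ (2 * D) ^ (ω - 1) :=
          Real.rpow_le_rpow hnpos.le hn (by linarith)
      _ = 2 ^ (ω - 1) * (D : ℝ) ^ (ω - 1) := Real.mul_rpow (by norm_num) hDpos.le
      _ ≤ _ := by
        refine mul_le_mul_of_nonneg_right ?_ (by positivity)
        exact Real.rpow_le_rpow_of_exponent_le (by norm_num) (by linarith)
  have hXY : ((2 ^ e : ℕ) : ℝ) ^ ω = ((2 ^ e : ℕ) : ℝ) * ((2 ^ e : ℕ) : ℝ) ^ (ω - 1) := by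
    rw [Real.rpow_sub_one hnpos.ne']
    field_simp
  have hqX : q * ((2 ^ e : ℕ) : ℝ) ^ ω ≤
      m * ((2 ^ e : ℕ) : ℝ) ^ (ω - 1) + ((2 ^ e : ℕ) : ℝ) ^ ω := by
    have h1 : (q : ℝ) * ((2 ^ e : ℕ) : ℝ) ≤ m + ((2 ^ e : ℕ) : ℝ) := by exact_mod_cast hq
    have h2 : 0 ≤ ((2 ^ e : ℕ) : ℝ) ^ (ω - 1) := by positivity
    rw [hXY]
    nlinarith
  have hX0 : 0 ≤ ((2 ^ e : ℕ) : ℝ) ^ ω := by positivity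
  have hY0 : 0 ≤ ((2 ^ e : ℕ) : ℝ) ^ (ω - 1) := by positivity
  rw [← Finset.sum_mul]
  set a := |c| + rankConst ω c + 1 with ha
  have ha1 : |c| ≤ a := by linarith
  have ha2 : rankConst ω c ≤ a := by linarith [abs_nonneg c]
  have ha3 : rankConst ω c + 1 ≤ a := by linarith [abs_nonneg c]
  have ha4 : doublingConst ω c ≤ 2 * a := by unfold doublingConst; linarith
  have ha0 : 0 ≤ a := by linarith [abs_nonneg c]
  have hdbl0 : 0 ≤ doublingConst ω c := by unfold doublingConst; positivity
  have hm0 : (0 : ℝ) ≤ m := Nat.cast_nonneg m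
  generalize ((2 ^ e : ℕ) : ℝ) ^ ω = X at *
  generalize ((2 ^ e : ℕ) : ℝ) ^ (ω - 1) = Y at *
  generalize (D : ℝ) ^ ω = X' at *
  generalize (D : ℝ) ^ (ω - 1) = Y' at *
  generalize (2 : ℝ) ^ ω = w at *
  have hq0 : (0 : ℝ) ≤ q := Nat.cast_nonneg q
  have t1 : q * (rankConst ω c * X) ≤ a * (q * X) := by
    have := mul_le_mul_of_nonneg_right ha2 (mul_nonneg hq0 hX0)
    linarith
  have t2 : (∑ k : Fin r, ((Nat.clog 2 (d k) : ℝ) + 1)) * (doublingConst ω c * X) ≤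
      (2 * r + 2 * ℓ) * (2 * a * X) :=
    mul_le_mul hsum (mul_le_mul_of_nonneg_right ha4 hX0) (by positivity) (by positivity)
  have t3 : (rankConst ω c + 1 + (q + 2 * r) * |c|) * X ≤ a * ((1 + 2 * r) * X) + a * (q * X) := by
    have h1 : (q + 2 * r) * |c| ≤ (q + 2 * r) * a :=
      mul_le_mul_of_nonneg_left ha1 (by positivity)
    have h2 : rankConst ω c + 1 + (q + 2 * r) * |c| ≤ a + (q + 2 * r) * a := by linarith
    have h3 := mul_le_mul_of_nonneg_right h2 hX0
    linarith
  have t4 : a * (q * X) ≤ a * (m * Y + X) := mul_le_mul_of_nonneg_left hqX ha0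
  have t5 : m * Y ≤ m * (w * Y') := mul_le_mul_of_nonneg_left hY hm0
  have t6 : (r + ℓ) * X ≤ (r + ℓ) * (w * X') := mul_le_mul_of_nonneg_left hX (by positivity)
  have t7 : X ≤ r * X := le_mul_of_one_le_left hX0 hr'
  have t8 : 0 ≤ ℓ * X := mul_nonneg hℓ0 hX0
  calc _ ≤ a * (2 * (m * Y + X) + (1 + 2 * r) * X + (4 * r + 4 * ℓ) * X) := by linarith
    _ ≤ a * (10 * (m * Y + (r + ℓ) * X)) := by
      refine mul_le_mul_of_nonneg_left ?_ ha0
      have := mul_nonneg hm0 hY0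
      linarith
    _ ≤ a * (10 * (m * (w * Y') + (r + ℓ) * (w * X'))) := by
      refine mul_le_mul_of_nonneg_left ?_ ha0
      linarith
    _ = _ := by ring

theorem SyzygyTree.Solves.mono {P : SyzygyTree K r m D} {ord : ModuleMonomialOrder r m}
    {M : Fin r → Matrix (Fin D) (Fin D) K} {hM : ∀ i j, Commute (M i) (M j)}
    {F : Matrix (Fin m) (Fin D) K} {B B' : ℝ} (h : P.Solves ord M hM F B) (hB : B ≤ B') :
    P.Solves ord M hM F B' := by
  obtain ⟨s, h1, h2, h3⟩ := h
  exact ⟨s, h1, h2, h3.trans hB⟩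

/-- A single tree computes the reduced Gröbner basis: the doubling program finds the standard
monomials and their rows, and the output program solves for the normal forms of the minimal
leading monomials. -/
theorem exists_tree {ω c : ℝ} (hω : 2 < ω) (h : MatMulIn K ω c) (hr : 1 ≤ r) (hD : 1 ≤ D) :
    ∃ P : SyzygyTree K r m D,
      ∀ (ord : ModuleMonomialOrder r m) (M : Fin r → Matrix (Fin D) (Fin D) K)
        (hM : ∀ i j, Commute (M i) (M j)) (F : Matrix (Fin m) (Fin D) K),
        P.Solves ord M hM F (10 * ((|c| + rankConst ω c + 1) * 2 ^ ω) *
          ((m : ℝ) * (D : ℝ) ^ (ω - 1) +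
            (D : ℝ) ^ ω * (r + Real.log (∏ k, ((minpoly K (M k)).natDegree : ℝ))))) := by
  set e := Nat.clog 2 D with he
  have hDe : D ≤ 2 ^ e := Nat.le_pow_clog (by norm_num) D
  have heD : 2 ^ e ≤ 2 * D := by
    rcases Nat.eq_or_lt_of_le hD with h1 | h1
    · rw [he, ← h1]
      simp
    · have h2 : 2 ^ (e - 1) < D := Nat.pow_pred_clog_lt_self (by norm_num) h1
      have h3 : 1 ≤ e := Nat.clog_pos (by norm_num) h1
      obtain ⟨e', he'⟩ : ∃ e', e = e' + 1 := ⟨e - 1, by omega⟩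
      rw [he', Nat.add_sub_cancel] at h2
      rw [he', pow_succ]
      omega
  have hm : m ≤ (m / 2 ^ e + 1) * 2 ^ e := by
    rw [add_mul, one_mul]
    exact (Nat.lt_div_mul_add (by positivity)).le
  have hq : (m / 2 ^ e + 1) * 2 ^ e ≤ m + 2 ^ e := by
    rw [add_mul, one_mul]
    exact Nat.add_le_add_right (Nat.div_mul_le_self m _) _
  obtain ⟨p, hp⟩ := exists_standard (K := K) (r := r) (m := m) hω h e hDe (m / 2 ^ e + 1) hm r
    le_rfl
  obtain ⟨p', hp'⟩ := exists_output (K := K) (r := r) (m := m) hω h e hDe (m / 2 ^ e + 1) hm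
  refine ⟨((p >>= fun o => p' o.1 o.2) 0).bind fun a => .halt a.1, ?_⟩
  intro ord M hM F
  have hdeg := fun k => natDegree_minpoly_mem_Icc hD (M k)
  let E : Env K (SyzygyInput r m D) (Mon r m × Mon r m) :=
    ⟨syzygyInput M F, fun x => ord.lt x.1 x.2⟩
  obtain ⟨k, t, a, hrun, -, hk, hG⟩ := (hp M hM F ord E rfl (fun _ => Iff.rfl)
    (fun k => (hdeg k).2) ⟨0, fun _ => 0⟩).bind fun o s _ ho =>
      hp' M hM F ord E rfl (fun _ => Iff.rfl) s o.1 o.2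
        (by rw [ho.1, firstVars_all]) ho.2
  refine ⟨⟨k, Sum.elim (syzygyInput M F) t.val, a⟩, ?_, hG, hk.trans ?_⟩
  · unfold CompTree.run
    rw [CompTree.runFrom_bind _ _ _ _ _ _ _ _ hrun]
    simp [CompTree.runFrom, Outcome.charge, E]
  · have := cost_le hω c hD hr (m := m) (fun k => (hdeg k).1) heD hq
    simpa using this

theorem bound_le_log_bound {ω : ℝ} {D m r : ℕ} (hD : 2 ≤ D) {d : Fin r → ℕ}
    (hd : ∀ k, d k ∈ Set.Icc 1 D) :
    (m : ℝ) * (D : ℝ) ^ (ω - 1) + (D : ℝ) ^ ω * (r + Real.log (∏ k, (d k : ℝ))) ≤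
      3 * ((m : ℝ) * (D : ℝ) ^ (ω - 1) + r * (D : ℝ) ^ ω * Real.log D) := by
  have h1 : Real.log (∏ k, (d k : ℝ)) ≤ r * Real.log D := by
    rw [Real.log_prod fun k _ => by have := (hd k).1; positivity]
    calc _ ≤ ∑ _k : Fin r, Real.log D := Finset.sum_le_sum fun k _ =>
          Real.log_le_log (by have := (hd k).1; positivity) (by exact_mod_cast (hd k).2)
      _ = _ := by simp
  have h2 : 1 ≤ 2 * Real.log D := by
    have h3 := Real.log_two_gt_d9
    have h4 : Real.log 2 ≤ Real.log D := Real.log_le_log (by norm_num) (by exact_mod_cast hD)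
    linarith
  have h5 : (r : ℝ) ≤ 2 * (r * Real.log D) := by
    have := mul_le_mul_of_nonneg_left h2 (Nat.cast_nonneg (α := ℝ) r)
    linarith
  have h6 : (0 : ℝ) ≤ m * (D : ℝ) ^ (ω - 1) := by positivity
  have h7 : (D : ℝ) ^ ω * (r + Real.log (∏ k, (d k : ℝ))) ≤
      (D : ℝ) ^ ω * (3 * (r * Real.log D)) :=
    mul_le_mul_of_nonneg_left (by linarith) (by positivity)
  linarith

end Total

end SyzygyGB

theorem theorem1p1 (ω c : ℝ) (hω : 2 < ω) :
    ∃ C : ℝ, ∀ (K : Type u) [Field K], SyzygyGB.MatMulIn K ω c →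
      ∀ r m D : ℕ, 1 ≤ r → 1 ≤ m → 1 ≤ D →
        ∃ P : SyzygyGB.SyzygyTree K r m D,
          ∀ (ord : SyzygyGB.ModuleMonomialOrder r m) (M : Fin r → Matrix (Fin D) (Fin D) K)
            (hM : ∀ i j, Commute (M i) (M j)) (F : Matrix (Fin m) (Fin D) K),
            (∀ k, (minpoly K (M k)).natDegree ∈ Set.Icc 1 D) ∧
            P.Solves ord M hM F
              (C * ((m : ℝ) * (D : ℝ) ^ (ω - 1) +
                (D : ℝ) ^ ω * (r + Real.log (∏ k, ((minpoly K (M k)).natDegree : ℝ))))) ∧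
            (2 ≤ D → P.Solves ord M hM F
              (C * ((m : ℝ) * (D : ℝ) ^ (ω - 1) + r * (D : ℝ) ^ ω * Real.log D))) := by
  refine ⟨30 * ((|c| + SyzygyGB.rankConst ω c + 1) * 2 ^ ω), fun K _ h r m D hr _ hD => ?_⟩
  obtain ⟨P, hP⟩ := SyzygyGB.exists_tree (K := K) (m := m) hω h hr hD
  refine ⟨P, fun ord M hM F => ?_⟩
  have hdeg := fun k => SyzygyGB.natDegree_minpoly_mem_Icc hD (M k)
  have hC : 0 ≤ 10 * ((|c| + SyzygyGB.rankConst ω c + 1) * 2 ^ ω) := by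
    have := SyzygyGB.rankConst_pos hω c
    positivity
  refine ⟨hdeg, (hP ord M hM F).mono ?_,
    fun hD2 => (hP ord M hM F).mono ?_⟩
  · refine mul_le_mul_of_nonneg_right ?_ ?_
    · linarith
    · have : 0 ≤ Real.log (∏ k, ((minpoly K (M k)).natDegree : ℝ)) :=
        SyzygyGB.log_prod_natCast_nonneg fun k => (hdeg k).1
      positivity
  · have := mul_le_mul_of_nonneg_left (SyzygyGB.bound_le_log_bound (ω := ω) (m := m) hD2 hdeg) hC
    linarith
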